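/- Let $X,U,Y,Z$ be complex Banach spaces ($Y$ may be infinite-dimensional). **Exosystem.** Let $W$ be a separable complex Hilbert space with orthonormal basis $\{\phi_k^l : k\in J,\ 1\le l\le n_k\}$, where $J$ is a non-empty countable index set (such as $\mathbb Z$, or a finite set if $\dim W<\infty$) and $1\le n_k\le N$ for some $N$. Let $\omega_k\in\mathbb R$, put $S_kv=\sum_{l=1}^{n_k}\langle v,\phi_k^l\rangle(i\omega_k\phi_k^l+\phi_k^{l-1})$ with $\phi_k^0=0$, and $Sv=\sum_kS_kv$ with $D(S)=\{v\in W:\sum_k\|S_kv\|^2<\infty\}$. $S$ generates the group $T_S(t)v=\sum_ke^{i\omega_kt}\sum_{l=1}^{n_k}\langle v,\phi_k^l\rangle\sum_{j=1}^l\frac{t^{l-j}}{(l-j)!}\phi_k^j$. Let $P_k$ be the orthogonal projection onto $\mathrm{span}\{\phi_k^l\}_{l=1}^{n_k}$ and, for $\alpha\ge0$, $W_\alpha=\{v\in W:\|v\|_\alpha^2=\sum_k(1+\omega_k^2)^\alpha\|P_kv\|^2<\infty\}$. Fix $\alpha\ge 0$. **Plant.** $A$ generates a strongly continuous semigroup on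 $X$; for a fixed $\lambda_0\in\rho(A)$ let $X_1=(D(A),\|(\lambda_0-A)\cdot\|)$, let $X_{-1}$ be the completion of $(X,\|R(\lambda_0,A)\cdot\|)$, and let $A_{-1}:X\to X_{-1}$ be the continuous extension of $A$. Let $B\in\mathcal L(U,X_{-1})$, $D\in\mathcal L(U,Y)$, and let $C:D(C)\subset X\to Y$ be linear with $D(A)\subset D(C)$, $C|_{D(A)}\in\mathcal L(X_1,Y)$, $\mathrm{ran}(R(\lambda_0,A_{-1})B)\subset D(C)$ and $CR(\lambda_0,A_{-1})B\in\mathcal L(U,Y)$. Let $E\in\mathcal L(W,X)$, $F\in\mathcal L(W,Y)$, and assume $i\omega_k\in\rho(A)$ for all $k$. **Controller.** $\mathcal G_1$ generates a strongly continuous semigroup on $Z$, $\mathcal G_2\in\mathcal L(Y,Z)$, and $K:D(K)\subset Z\to U$ is linear with $D(\mathcal G_1)\subset D(K)$ and bounded on $D(\mathcal G_1)$ with its graph norm. **Closed loop.** On $X_e=X\times Z$ let $$A_e=\begin{pmatrix}A_{-1}&BK\\ \mathcal G_2C&\mathcal G_1+\mathcal G_2DK\end{pmatrix},\quad D(A_e)=\{(x,z)\in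 D(C)\times D(\mathcal G_1):A_{-1}x+BKz\in X\},$$ $B_e=(E,\mathcal G_2F)^T$, $C_e=(C,\ DK)$ with $D(C_e)=D(C)\times D(K)$, and assume that $C_e$ is relatively bounded with respect to $A_e$. When $A_e$ generates a strongly continuous semigroup $T_e$, the regulation error for initial states $x_{e0},v_0$ is $e(t)=C_ex_e(t)+FT_S(t)v_0$, where $x_e(t)=T_e(t)x_{e0}+\int_0^tT_e(t-s)B_eT_S(s)v_0\,ds$. "The Sylvester equation $\Sigma S=A_e\Sigma+B_e$ has a solution $\Sigma\in\mathcal L(W_\alpha,X_e)$" means that $\Sigma(W_{\alpha+1})\subset D(A_e)$ and $\Sigma Sv=A_e\Sigma v+B_ev$ for all $v\in W_{\alpha+1}$. **Robust output regulation problem on $W_\alpha$.** Let $\mathcal O$ be the class of all $(\tilde A,\tilde B,\tilde C,\tilde D,\tilde E,\tilde F)$ (on the same spaces) such that $(\tilde A,\tilde B,\tilde C,\tilde D)$ satisfies the plant assumptions above (with its own scale spaces), $\tilde E\in\mathcal L(W,X)$, $\tilde F\in\mathcal L(W,Y)$, $i\omega_k\in\rho(\tilde A)$ for all $k$, the corresponding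 $\tilde A_e$ generates a strongly stable strongly continuous semigroup, $\tilde C_e$ is $\tilde A_e$-bounded, and $\Sigma S=\tilde A_e\Sigma+\tilde B_e$ has a solution $\Sigma\in\mathcal L(W_\alpha,X_e)$. The controller $(\mathcal G_1,\mathcal G_2,K)$ solves the problem if (a) $A_e$ generates a strongly stable semigroup; (b) for all $x_{e0}\in D(A_e)$ and $v_0\in W_{\alpha+1}$ the regulation error is defined for all $t\ge0$ and $e(t)\to0$ as $t\to\infty$; (c) for every element of $\mathcal O$ the same holds for the perturbed closed loop, for all $x_{e0}\in D(\tilde A_e)$ and $v_0\in W_{\alpha+1}$. **$\mathcal G$-conditions.** $\mathrm{ran}(i\omega_k-\mathcal G_1)\cap\mathrm{ran}(\mathcal G_2)=\{0\}$ for all $k$; $\ker\mathcal G_2=\{0\}$; and $\ker(i\omega_k-\mathcal G_1)^{n_k-1}\subset\mathrm{ran}(i\omega_k-\mathcal G_1)$ for all $k$. **Theorem.** Assume that $A_e$ generates a strongly stable strongly continuous semigroup, that $Z=\mathrm{ran}(i\omega_k-\mathcal G_1)+\mathrm{ran}(\mathcal G_2)$ for all $k$, and that $\Sigma S=A_e\Sigma+B_e$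 has a solution $\Sigma\in\mathcal L(W_\alpha,X_e)$. Then the controller $(\mathcal G_1,\mathcal G_2,K)$ solves the robust output regulation problem on $W_\alpha$ if and only if it satisfies the $\mathcal G$-conditions. -/

import Mathlib

open Filter Topology

noncomputable section

namespace RobustReg

/-! ### Unbounded operators and strongly continuous semigroups -/

section Operators

variable {E F : Type*} [NormedAddCommGroup E] [NormedSpace ℂ E]
  [NormedAddCommGroup F] [NormedSpace ℂ F]

/-- The operator `μ - A` with domain `Dom(A)`. -/
def shift (A : E →ₗ.[ℂ] E) (μ : ℂ) : E →ₗ.[ℂ] E where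
  domain := A.domain
  toFun := μ • A.domain.subtype - A.toFun

/-- The range of an unbounded operator. -/
def ran (A : E →ₗ.[ℂ] F) : Submodule ℂ F := LinearMap.range A.toFun

/-- The bounded operator `R` is a two-sided inverse of `μ - A : Dom(A) → E`. -/
def IsResolvent (A : E →ₗ.[ℂ] E) (μ : ℂ) (R : E →L[ℂ] E) : Prop :=
  (∀ x : E, (R x, x) ∈ (shift A μ).graph) ∧
    ∀ x : (shift A μ).domain, R (shift A μ x) = x

/-- The resolvent set `ρ(A)`. -/
def rho (A : E →ₗ.[ℂ] E) : Set ℂ := {μ | ∃ R : E →L[ℂ] E, IsResolvent A μ R}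

open Classical in
/-- The resolvent operator `R(μ, A) = (μ - A)⁻¹` for `μ ∈ ρ(A)` (and `0` otherwise). -/
def res (A : E →ₗ.[ℂ] E) (μ : ℂ) : E →L[ℂ] E :=
  if h : ∃ R : E →L[ℂ] E, IsResolvent A μ R then h.choose else 0

theorem res_spec {A : E →ₗ.[ℂ] E} {μ : ℂ} (h : μ ∈ rho A) : IsResolvent A μ (res A μ) := by
  have h' : ∃ R : E →L[ℂ] E, IsResolvent A μ R := h
  rw [res, dif_pos h']
  exact h'.choose_spec

theorem res_injective {A : E →ₗ.[ℂ] E} {μ : ℂ} (h : μ ∈ rho A) {x : E} (hx : res A μ x = 0) :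
    x = 0 := by
  have h1 := (res_spec h).1 x
  rw [hx] at h1
  exact LinearPMap.graph_fst_eq_zero_snd _ h1 rfl

/-- The kernel of `(μ - A)^m`, where the powers carry their natural domains
(`Dom((μ - A)^(m+1)) = {x ∈ Dom(A) | (μ - A) x ∈ Dom((μ - A)^m)}`). -/
def kerPow (A : E →ₗ.[ℂ] E) (μ : ℂ) : ℕ → Set E
  | 0 => {0}
  | m + 1 => {x | ∃ y, (x, y) ∈ (shift A μ).graph ∧ y ∈ kerPow A μ m}

/-- `C ∈ L(E₁, F)`, where `E₁ = (Dom(A), ‖(μ - A) ·‖)`. The operator `C` may have a domain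
larger than `Dom(A)`. -/
def ScaleBounded (A : E →ₗ.[ℂ] E) (μ : ℂ) (C : E →ₗ.[ℂ] F) : Prop :=
  A.domain ≤ C.domain ∧
    ∃ c : ℝ, ∀ x y z, (x, y) ∈ (shift A μ).graph → (x, z) ∈ C.graph → ‖z‖ ≤ c * ‖y‖

/-- `C` is relatively bounded with respect to `A`. -/
def RelBounded (A : E →ₗ.[ℂ] E) (C : E →ₗ.[ℂ] F) : Prop :=
  A.domain ≤ C.domain ∧
    ∃ a b : ℝ, ∀ x y z, (x, y) ∈ A.graph → (x, z) ∈ C.graph → ‖z‖ ≤ a * ‖x‖ + b * ‖y‖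

/-- `T` is a strongly continuous semigroup; only the values `T t` with `0 ≤ t` matter. -/
structure IsC0Semigroup (T : ℝ → E →L[ℂ] E) : Prop where
  map_zero : T 0 = ContinuousLinearMap.id ℂ E
  map_add : ∀ s t, 0 ≤ s → 0 ≤ t → T (s + t) = (T s).comp (T t)
  tendsto_zero : ∀ x, Tendsto (fun t => T t x) (𝓝[>] 0) (𝓝 x)

/-- `A`, with its domain, is the infinitesimal generator of `T`. -/
def IsGenerator (A : E →ₗ.[ℂ] E) (T : ℝ → E →L[ℂ] E) : Prop :=
  ∀ x y, (x, y) ∈ A.graph ↔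
    Tendsto (fun t : ℝ => (t : ℂ)⁻¹ • (T t x - x)) (𝓝[>] 0) (𝓝 y)

/-- `A` generates the strongly continuous semigroup `T`. -/
def Generates (A : E →ₗ.[ℂ] E) (T : ℝ → E →L[ℂ] E) : Prop :=
  IsC0Semigroup T ∧ IsGenerator A T

/-- `T` is strongly stable. -/
def StronglyStable (T : ℝ → E →L[ℂ] E) : Prop :=
  ∀ x, Tendsto (fun t => T t x) atTop (𝓝 0)

/-- The mild state `x(t) = T(t) x₀ + ∫₀ᵗ T(t - s) f(s) ds`. -/
def mildState (T : ℝ → E →L[ℂ] E) (x₀ : E) (f : ℝ → E) (t : ℝ) : E :=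
  T t x₀ + ∫ s in (0 : ℝ)..t, T (t - s) (f s)

end Operators

/-! ### The extrapolation space -/

section Extrapolation

variable {X : Type*} [NormedAddCommGroup X] [NormedSpace ℂ X]

/-- The space `X` with the norm `‖R(μ, A) ·‖`. -/
def PreExtrap (_A : X →ₗ.[ℂ] X) (_μ : ℂ) : Type _ := X

variable (A : X →ₗ.[ℂ] X) (μ : ℂ)

instance : AddCommGroup (PreExtrap A μ) := inferInstanceAs (AddCommGroup X)

instance : Module ℂ (PreExtrap A μ) := inferInstanceAs (Module ℂ X)

/-- The identity `X → (X, ‖R(μ, A) ·‖)`. -/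
def toPreExtrap : X ≃ₗ[ℂ] PreExtrap A μ := LinearEquiv.refl ℂ X

/-- The operator `R(μ, A)`, seen as a linear map on `(X, ‖R(μ, A) ·‖)`. -/
def preRes : PreExtrap A μ →ₗ[ℂ] X := (res A μ).toLinearMap.comp (toPreExtrap A μ).symm.toLinearMap

instance : SeminormedAddCommGroup (PreExtrap A μ) :=
  SeminormedAddCommGroup.induced (PreExtrap A μ) X (preRes A μ)

instance : NormedSpace ℂ (PreExtrap A μ) :=
  NormedSpace.induced ℂ (PreExtrap A μ) X (preRes A μ)

/-- The extrapolation space `X₋₁`, the completion of `(X, ‖R(μ, A) ·‖)`. -/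
abbrev Extrap : Type _ := UniformSpace.Completion (PreExtrap A μ)

/-- The embedding `X → X₋₁`. -/
def embed : X →ₗ[ℂ] Extrap A μ :=
  (UniformSpace.Completion.toComplₗᵢ (𝕜 := ℂ) (E := PreExtrap A μ)).toLinearMap.comp
    (toPreExtrap A μ).toLinearMap

theorem norm_embed (x : X) : ‖embed A μ x‖ = ‖res A μ x‖ :=
  (UniformSpace.Completion.toComplₗᵢ (𝕜 := ℂ) (E := PreExtrap A μ)).norm_map (toPreExtrap A μ x)

theorem embed_eq_zero {A : X →ₗ.[ℂ] X} {μ : ℂ} (h : μ ∈ rho A) {x : X}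
    (hx : embed A μ x = 0) : x = 0 := by
  apply res_injective h
  rw [← norm_eq_zero, ← norm_embed, hx, norm_zero]

/-- The extension `A₋₁ : X → X₋₁` of `A` by density of `Dom(A)` in `X`. -/
def extOp : X →L[ℂ] Extrap A μ :=
  ((embed A μ).comp A.toFun).extendOfNorm A.domain.subtype

/-- The resolvent `R(l, A₋₁) : X₋₁ → X`, for `l ∈ ρ(A)`: the extension of `R(l, A)` by density of
`X` in `X₋₁`. -/
def extRes [CompleteSpace X] (l : ℂ) : Extrap A μ →L[ℂ] X :=
  (res A l).toLinearMap.extendOfNorm (embed A μ)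

end Extrapolation

/-! ### Plant and controller -/

/-- A plant `(A, B, C, D)` with state space `X`, input space `U` and output space `Y`. The point
`lam` is the point of the resolvent set by which the norms of the scale spaces `X₁` and `X₋₁` are
defined. -/
structure Plant (X U Y : Type*) [NormedAddCommGroup X] [NormedSpace ℂ X] [CompleteSpace X]
    [NormedAddCommGroup U] [NormedSpace ℂ U] [NormedAddCommGroup Y] [NormedSpace ℂ Y] where
  /-- the system operator -/
  A : X →ₗ.[ℂ] X
  generates : ∃ T, Generates A T
  lam : ℂ
  lam_mem : lam ∈ rho A
  /-- the input operator `B ∈ L(U, X₋₁)` -/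
  B : U →L[ℂ] Extrap A lam
  /-- the output operator `C ∈ L(X₁, Y)` -/
  C : X →ₗ.[ℂ] Y
  C_bounded : ScaleBounded A lam C
  /-- the feedthrough operator -/
  D : U →L[ℂ] Y
  /-- `ran(R(lam, A₋₁) B) ⊂ Dom(C)` and `C R(lam, A₋₁) B ∈ L(U, Y)` -/
  CRB_bounded : ∃ M : U →L[ℂ] Y, ∀ u, (extRes A lam lam (B u), M u) ∈ C.graph

/-- An error feedback controller `(G₁, G₂, K)` on `Z`. -/
structure Controller (Y Z U : Type*) [NormedAddCommGroup Y] [NormedSpace ℂ Y]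
    [NormedAddCommGroup Z] [NormedSpace ℂ Z] [NormedAddCommGroup U] [NormedSpace ℂ U] where
  G₁ : Z →ₗ.[ℂ] Z
  generates : ∃ T, Generates G₁ T
  G₂ : Y →L[ℂ] Z
  K : Z →ₗ.[ℂ] U
  /-- `K ∈ L(Z₁, U)` -/
  K_bounded : ∃ μ ∈ rho G₁, ScaleBounded G₁ μ K

/-! ### The closed-loop system -/

section ClosedLoop

variable {X U Y Z : Type*} [NormedAddCommGroup X] [NormedSpace ℂ X] [CompleteSpace X]
  [NormedAddCommGroup U] [NormedSpace ℂ U] [NormedAddCommGroup Y] [NormedSpace ℂ Y]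
  [NormedAddCommGroup Z] [NormedSpace ℂ Z]

/-- The graph of the closed-loop operator `A_e` with maximal domain: `((x, z), (x', z'))` with
`x ∈ Dom(C)`, `z ∈ Dom(G₁)` (`⊂ Dom(K)`), `A₋₁ x + B K z = x'` in `X₋₁` (so that
`A₋₁ x + B K z ∈ X`), and `z' = G₂ C x + G₁ z + G₂ D K z`. -/
def closedLoopGraph (P : Plant X U Y) (G : Controller Y Z U) :
    Submodule ℂ ((X × Z) × (X × Z)) where
  carrier := {p | ∃ (y : Y) (u : U) (w : Z),
    (p.1.1, y) ∈ P.C.graph ∧ (p.1.2, w) ∈ G.G₁.graph ∧ (p.1.2, u) ∈ G.K.graph ∧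
    extOp P.A P.lam p.1.1 + P.B u = embed P.A P.lam p.2.1 ∧
    p.2.2 = G.G₂ y + (w + G.G₂ (P.D u))}
  zero_mem' := ⟨0, 0, 0, P.C.graph.zero_mem, G.G₁.graph.zero_mem, G.K.graph.zero_mem,
    by simp, by simp⟩
  add_mem' := by
    rintro p q ⟨y, u, w, h1, h2, h3, h4, h5⟩ ⟨y', u', w', h1', h2', h3', h4', h5'⟩
    refine ⟨y + y', u + u', w + w', P.C.graph.add_mem h1 h1', G.G₁.graph.add_mem h2 h2',
      G.K.graph.add_mem h3 h3', ?_, ?_⟩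
    · simp only [Prod.fst_add, Prod.snd_add, map_add, ← h4, ← h4']
      abel
    · simp only [Prod.snd_add, map_add, h5, h5']
      abel
  smul_mem' := by
    rintro c p ⟨y, u, w, h1, h2, h3, h4, h5⟩
    refine ⟨c • y, c • u, c • w, P.C.graph.smul_mem c h1, G.G₁.graph.smul_mem c h2,
      G.K.graph.smul_mem c h3, ?_, ?_⟩
    · simp only [Prod.smul_fst, Prod.smul_snd, map_smul, ← h4, smul_add]
    · simp only [Prod.smul_snd, map_smul, h5, smul_add]

/-- The closed-loop operator `A_e` on `X_e = X × Z`, with maximal domain. -/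
def Ae (P : Plant X U Y) (G : Controller Y Z U) : (X × Z) →ₗ.[ℂ] (X × Z) :=
  (closedLoopGraph P G).toLinearPMap

theorem Ae_graph (P : Plant X U Y) (G : Controller Y Z U) :
    (Ae P G).graph = closedLoopGraph P G := by
  apply Submodule.toLinearPMap_graph_eq
  rintro ⟨⟨x, z⟩, ⟨x', z'⟩⟩ ⟨y, u, w, h1, h2, h3, h4, h5⟩ h0
  obtain ⟨rfl, rfl⟩ := Prod.mk.inj h0
  dsimp only at h1 h2 h3 h4 h5
  have hy : y = 0 := LinearPMap.graph_fst_eq_zero_snd _ h1 rfl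
  have hw : w = 0 := LinearPMap.graph_fst_eq_zero_snd _ h2 rfl
  have hu : u = 0 := LinearPMap.graph_fst_eq_zero_snd _ h3 rfl
  subst hy hw hu
  have hx : x' = 0 := embed_eq_zero P.lam_mem (by rw [← h4]; simp)
  subst hx
  simp [h5]

/-- The output operator `C_e = (C, D K)` with domain `Dom(C) × Dom(K)`. -/
def Ce (P : Plant X U Y) (G : Controller Y Z U) : (X × Z) →ₗ.[ℂ] Y :=
  P.C.coprod (P.D.toLinearMap.compPMap G.K)

/-- The operator `B_e = (E, G₂ F)`. -/
def Be {W : Type*} [NormedAddCommGroup W] [NormedSpace ℂ W]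
    (G : Controller Y Z U) (E : W →L[ℂ] X) (F : W →L[ℂ] Y) : W →L[ℂ] X × Z :=
  E.prod (G.G₂.comp F)

/-- The closed-loop operator `A_e` generates a strongly stable strongly continuous semigroup. -/
def StablyGenerates (P : Plant X U Y) (G : Controller Y Z U) : Prop :=
  ∃ T, Generates (Ae P G) T ∧ StronglyStable T

end ClosedLoop

/-! ### The exosystem -/

/-- The data of a block diagonal exosystem on `W`: frequencies `ω k`, uniformly bounded block sizes
`n k ≥ 1` and an orthonormal basis `φ ⟨k, l⟩` of `W`, where `l` runs through `0, …, n k - 1`. -/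
structure Exosystem (ι W : Type*) [NormedAddCommGroup W] [InnerProductSpace ℂ W] where
  ω : ι → ℝ
  n : ι → ℕ
  n_pos : ∀ k, 1 ≤ n k
  n_bdd : ∃ N, ∀ k, n k ≤ N
  φ : HilbertBasis (Σ k, Fin (n k)) ℂ W

namespace Exosystem

variable {ι W : Type*} [NormedAddCommGroup W] [InnerProductSpace ℂ W]

/-- The eigenvalue `i ω_k`. -/
def freq (S : Exosystem ι W) (k : ι) : ℂ := Complex.I * (S.ω k : ℂ)

/-- The coefficient `⟨v, φ_k^l⟩` (the inner product being linear in `v`). -/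
def coeff (S : Exosystem ι W) (k : ι) (l : Fin (S.n k)) : W →ₗ[ℂ] ℂ :=
  (innerSL ℂ (S.φ ⟨k, l⟩)).toLinearMap

/-- The projection `P_k` onto the span of `φ_k^l`, `l = 1, …, n_k`. -/
def proj (S : Exosystem ι W) (k : ι) : W →ₗ[ℂ] W :=
  ∑ l, (S.coeff k l).smulRight (S.φ ⟨k, l⟩)

/-- The predecessor `φ_k^(l-1)` of `φ_k^l` in its Jordan chain, `0` for the first element. -/
def pred (S : Exosystem ι W) (k : ι) (l : Fin (S.n k)) : W :=
  if (l : ℕ) = 0 then 0 else S.φ ⟨k, ⟨(l : ℕ) - 1, by omega⟩⟩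

/-- The Jordan block `S_k`. -/
def block (S : Exosystem ι W) (k : ι) : W →ₗ[ℂ] W :=
  ∑ l, (S.coeff k l).smulRight (S.freq k • S.φ ⟨k, l⟩ + S.pred k l)

theorem summable_sq_add {W : Type*} [NormedAddCommGroup W] {w : ι → ℝ} (hw : ∀ k, 0 ≤ w k) {f g : ι → W}
    (hf : Summable fun k => w k * ‖f k‖ ^ 2) (hg : Summable fun k => w k * ‖g k‖ ^ 2) :
    Summable fun k => w k * ‖f k + g k‖ ^ 2 := by
  refine Summable.of_nonneg_of_le (fun k => mul_nonneg (hw k) (sq_nonneg _)) (fun k => ?_)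
    ((hf.mul_left 2).add (hg.mul_left 2))
  have h1 : ‖f k + g k‖ ^ 2 ≤ 2 * ‖f k‖ ^ 2 + 2 * ‖g k‖ ^ 2 := by
    nlinarith [norm_add_le (f k) (g k), norm_nonneg (f k + g k), sq_nonneg (‖f k‖ - ‖g k‖),
      norm_nonneg (f k), norm_nonneg (g k)]
  nlinarith [mul_le_mul_of_nonneg_left h1 (hw k)]

theorem summable_sq_smul {w : ι → ℝ} (c : ℂ) {f : ι → W}
    (hf : Summable fun k => w k * ‖f k‖ ^ 2) : Summable fun k => w k * ‖c • f k‖ ^ 2 := by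
  have h := hf.mul_left (‖c‖ ^ 2)
  refine h.congr fun k => ?_
  rw [norm_smul]
  ring

/-- The graph of the system operator `S v = ∑ S_k v` with domain `{v | ∑ ‖S_k v‖² < ∞}`. The
vectors `S_k v` are pairwise orthogonal, so that the series converges on this domain. -/
def opGraph (S : Exosystem ι W) : Submodule ℂ (W × W) where
  carrier := {p | (Summable fun k => ‖S.block k p.1‖ ^ 2) ∧
    HasSum (fun k => S.block k p.1) p.2}
  zero_mem' := by simp [summable_zero, hasSum_zero]
  add_mem' := by
    rintro p q ⟨h1, h2⟩ ⟨h1', h2'⟩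
    refine ⟨?_, ?_⟩
    · simpa using summable_sq_add (w := fun _ => 1) (fun _ => zero_le_one)
        (by simpa using h1) (by simpa using h1')
    · simpa using h2.add h2'
  smul_mem' := by
    rintro c p ⟨h1, h2⟩
    refine ⟨?_, ?_⟩
    · simpa using summable_sq_smul (w := fun _ => 1) c (by simpa using h1)
    · simpa using h2.const_smul c

/-- The system operator `S` of the exosystem. -/
def op (S : Exosystem ι W) : W →ₗ.[ℂ] W := S.opGraph.toLinearPMap

theorem op_graph (S : Exosystem ι W) : S.op.graph = S.opGraph := by
  apply Submodule.toLinearPMap_graph_eq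
  rintro ⟨v, w⟩ ⟨-, h⟩ h0
  dsimp only at h h0
  subst h0
  simpa using h.unique (by simp)

/-- The group `T_S(t) v = ∑_k exp(i ω_k t) ∑_l ⟨v, φ_k^l⟩ ∑_{j ≤ l} t^(l-j)/(l-j)! φ_k^j`
generated by `S`. -/
def flow (S : Exosystem ι W) (t : ℝ) (v : W) : W :=
  ∑' k, Complex.exp (S.freq k * t) • ∑ l, S.coeff k l v •
    ∑ j ∈ Finset.univ.filter (fun j => j ≤ l),
      ((t : ℂ) ^ ((l : ℕ) - (j : ℕ)) / (Nat.factorial ((l : ℕ) - (j : ℕ)) : ℂ)) • S.φ ⟨k, j⟩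

/-- The scale space `W_α`. -/
def scale (S : Exosystem ι W) (α : ℝ) : Submodule ℂ W where
  carrier := {v | Summable fun k => (1 + S.ω k ^ 2) ^ α * ‖S.proj k v‖ ^ 2}
  zero_mem' := by simp [summable_zero]
  add_mem' := by
    intro v w hv hw
    simpa using summable_sq_add (fun k => by positivity) hv hw
  smul_mem' := by
    intro c v hv
    simpa using summable_sq_smul c hv

/-- The norm of `W_α`. -/
def scaleNorm (S : Exosystem ι W) (α : ℝ) (v : W) : ℝ :=
  Real.sqrt (∑' k, (1 + S.ω k ^ 2) ^ α * ‖S.proj k v‖ ^ 2)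

end Exosystem

/-! ### Robust output regulation -/

section Regulation

variable {ι X U Y Z W : Type*} [NormedAddCommGroup X] [NormedSpace ℂ X] [CompleteSpace X]
  [NormedAddCommGroup U] [NormedSpace ℂ U] [NormedAddCommGroup Y] [NormedSpace ℂ Y]
  [NormedAddCommGroup Z] [NormedSpace ℂ Z] [NormedAddCommGroup W] [InnerProductSpace ℂ W]

/-- The Sylvester equation `Σ S = A_e Σ + B_e` on `W_(α+1)` has a solution `Σ ∈ L(W_α, X_e)` with
`Σ(W_(α+1)) ⊂ Dom(A_e)`. -/
def SylvesterSolvable (S : Exosystem ι W) (α : ℝ) (P : Plant X U Y) (G : Controller Y Z U)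
    (E : W →L[ℂ] X) (F : W →L[ℂ] Y) : Prop :=
  ∃ Sig : S.scale α →ₗ[ℂ] X × Z,
    (∃ c : ℝ, ∀ v, ‖Sig v‖ ≤ c * S.scaleNorm α v) ∧
    ∀ v : S.scale α, (v : W) ∈ S.scale (α + 1) →
      ∃ (Sv : S.scale α) (a : X × Z), ((v : W), (Sv : W)) ∈ S.op.graph ∧
        (Sig v, a) ∈ (Ae P G).graph ∧ Sig Sv = a + Be G E F v

/-- With `T_e` the semigroup generated by `A_e`: for all `x₀ ∈ Dom(A_e)` and `v₀ ∈ W_(α+1)` the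
closed-loop state `x_e(t)` stays in `Dom(C_e)` and the regulation error
`e(t) = C_e x_e(t) + F v(t)` tends to zero as `t → ∞`. -/
def ErrorDecays (S : Exosystem ι W) (α : ℝ) (P : Plant X U Y) (G : Controller Y Z U)
    (E : W →L[ℂ] X) (F : W →L[ℂ] Y) : Prop :=
  ∃ T, Generates (Ae P G) T ∧
    ∀ x₀ ∈ (Ae P G).domain, ∀ v₀ ∈ S.scale (α + 1), ∃ e : ℝ → Y,
      (∀ t, 0 ≤ t →
        ∃ y, (mildState T x₀ (fun s => Be G E F (S.flow s v₀)) t, y) ∈ (Ce P G).graph ∧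
          e t = y + F (S.flow t v₀)) ∧
      Tendsto e atTop (𝓝 0)

/-- The class `𝒪` of perturbed operators `(A, B, C, D)`, `E`, `F`. -/
structure InPertClass (S : Exosystem ι W) (α : ℝ) (G : Controller Y Z U) (P : Plant X U Y)
    (E : W →L[ℂ] X) (F : W →L[ℂ] Y) : Prop where
  freq_mem : ∀ k, S.freq k ∈ rho P.A
  stable : StablyGenerates P G
  relBounded : RelBounded (Ae P G) (Ce P G)
  sylvester : SylvesterSolvable S α P G E F

/-- The controller solves the robust output regulation problem on `W_α`. -/
structure SolvesRORP (S : Exosystem ι W) (α : ℝ) (P : Plant X U Y) (G : Controller Y Z U)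
    (E : W →L[ℂ] X) (F : W →L[ℂ] Y) : Prop where
  stable : StablyGenerates P G
  regulates : ErrorDecays S α P G E F
  robust : ∀ (P' : Plant X U Y) (E' : W →L[ℂ] X) (F' : W →L[ℂ] Y),
    InPertClass S α G P' E' F' → ErrorDecays S α P' G E' F'

/-- The `𝒢`-conditions. -/
structure GConditions (S : Exosystem ι W) (G : Controller Y Z U) : Prop where
  disjoint : ∀ k, ran (shift G.G₁ (S.freq k)) ⊓ LinearMap.range G.G₂.toLinearMap = ⊥
  injective : LinearMap.ker G.G₂.toLinearMap = ⊥
  chains : ∀ k, kerPow G.G₁ (S.freq k) (S.n k - 1) ⊆ ran (shift G.G₁ (S.freq k))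

end Regulation

end RobustReg

end

noncomputable section

namespace RobustReg

/-! ### Strongly continuous semigroups -/

section Semigroup

variable {E : Type*} [NormedAddCommGroup E] [NormedSpace ℂ E] {T : ℝ → E →L[ℂ] E}

/-! A solution `Σ` of the Sylvester equation splits the closed-loop state into `T_e(t)(x₀ - Σ v₀) +
Σ T_S(t) v₀` (`IsSylvesterSolution.mildState_eq`). The first summand contributes a decaying output,
by strong stability and relative boundedness of `C_e`. Regulation therefore amounts to `(C_e Σ + F)
φ_k^j = 0` on all Jordan chains. This is enough by density (`IsSylvesterSolution.output_eq_zero`).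
It is necessary because, once the lower members of a chain give zero output, the steady-state error
started at `φ_k^j` is `exp(i ω_k t)` times a fixed vector
(`IsSylvesterSolution.output_chain_eq_zero`).

With `z_j` the controller component of `Σ φ_k^j`, the controller row of the Sylvester equation reads
`(i ω_k - G₁) z_j + z_{j-1} = G₂ (C_e Σ + F) φ_k^j`, with `z_{-1} = 0`. The plant does not occur in
it except through the output on the right, which is the source of robustness.

Sufficiency: by induction `z_{j-1}` lies in the kernel of `(i ω_k - G₁)^j`, hence in the range of `i
ω_k - G₁`. The common value of both sides then lies in the intersection of the two ranges, so it is
zero, and injectivity of `G₂` kills the output (`GConditions.output_chain_eq_zero`).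

Necessity: any `z_j` in the domain of `G₁` satisfying such relations with right-hand sides `G₂ y_j`
comes from a Sylvester solution after a change of `E` and `F` alone, with output `y_j`. Robustness
forces `y_j = 0` (`SolvesRORP.chain_eq_zero`). Suitable chains give the three `𝒢`-conditions, the
last one with the help of the range sum hypothesis (`SolvesRORP.gConditions`). -/

theorem IsC0Semigroup.tendsto_zero_Ici (hT : IsC0Semigroup T) (x : E) :
    Tendsto (fun t => T t x) (𝓝[≥] 0) (𝓝 x) := by
  have h : ContinuousWithinAt (fun t => T t x) (Set.Ioi 0) 0 := by
    simpa [ContinuousWithinAt, hT.map_zero] using hT.tendsto_zero x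
  simpa [ContinuousWithinAt, hT.map_zero] using continuousWithinAt_Ioi_iff_Ici.1 h

/-- `T t` is continuous and commutes with the difference quotients that define the generator. -/
theorem Generates.graph_apply {A : E →ₗ.[ℂ] E} (hA : Generates A T) {x y : E}
    (h : (x, y) ∈ A.graph) {t : ℝ} (ht : 0 ≤ t) : (T t x, T t y) ∈ A.graph := by
  refine (hA.2 _ _).2 ((((T t).continuous.tendsto _).comp ((hA.2 _ _).1 h)).congr' ?_)
  filter_upwards [self_mem_nhdsWithin] with s hs
  have h1 : T t (T s x) = T s (T t x) := by
    rw [← ContinuousLinearMap.comp_apply, ← ContinuousLinearMap.comp_apply,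
      ← hA.1.map_add t s ht (le_of_lt hs), ← hA.1.map_add s t (le_of_lt hs) ht, add_comm]
  simp [h1]

theorem mildState_add (T : ℝ → E →L[ℂ] E) (x y : E) (f : ℝ → E) (t : ℝ) :
    mildState T (x + y) f t = T t x + mildState T y f t := by
  rw [mildState, mildState, map_add, add_assoc]

variable [CompleteSpace E]

/-- Otherwise there are times tending to `0` with unbounded operator norms, although the orbits
converge along them; this contradicts the uniform boundedness principle. -/
theorem IsC0Semigroup.exists_bound_near_zero (hT : IsC0Semigroup T) :
    ∃ δ > 0, ∃ M, ∀ t, 0 ≤ t → t ≤ δ → ‖T t‖ ≤ M := by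
  by_contra! h
  -- Including `‖T 0‖` in the maximum excludes `t = 0`, since strong continuity is assumed only from
  -- the right of `0`.
  have h1 : ∀ n : ℕ, ∃ t, 0 ≤ t ∧ t ≤ 1 / ((n : ℝ) + 1) ∧ max ‖T 0‖ n < ‖T t‖ :=
    fun n => h _ (by positivity) _
  choose t ht0 htn htM using h1
  have hpos : ∀ n, 0 < t n := fun n => lt_of_le_of_ne (ht0 n) fun h => by
    have := htM n
    rw [← h] at this
    exact absurd this (not_lt.2 (le_max_left _ _))
  have hlim : Tendsto t atTop (𝓝[>] 0) := tendsto_nhdsWithin_iff.2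
    ⟨squeeze_zero ht0 htn tendsto_one_div_add_atTop_nhds_zero_nat, Eventually.of_forall hpos⟩
  obtain ⟨C, hC⟩ := banach_steinhaus (g := fun n => T (t n)) fun x => by
    obtain ⟨C, hC⟩ := ((hT.tendsto_zero x).comp hlim).norm.bddAbove_range
    exact ⟨C, fun n => hC ⟨n, rfl⟩⟩
  obtain ⟨n, hn⟩ := exists_nat_gt C
  exact absurd ((le_max_right _ _).trans_lt (htM n)) (not_lt.2 ((hC n).trans hn.le))

theorem IsC0Semigroup.exists_bound (hT : IsC0Semigroup T) (a : ℝ) :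
    ∃ M, 0 ≤ M ∧ ∀ t, 0 ≤ t → t ≤ a → ‖T t‖ ≤ M := by
  obtain ⟨δ, hδ, M, hM⟩ := hT.exists_bound_near_zero
  have hM0 : 0 ≤ M := (norm_nonneg _).trans (hM 0 le_rfl hδ.le)
  have key : ∀ n : ℕ, ∃ C, 0 ≤ C ∧ ∀ t, 0 ≤ t → t ≤ n * δ → ‖T t‖ ≤ C := by
    intro n
    induction n with
    | zero =>
      refine ⟨M, hM0, fun t h0 h1 => hM t h0 (h1.trans ?_)⟩
      simpa using hδ.le
    | succ n ih =>
      obtain ⟨C, hC0, hC⟩ := ih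
      refine ⟨max M (C * M), hM0.trans (le_max_left _ _), fun t h0 h1 => ?_⟩
      rcases le_total t δ with h | h
      · exact (hM t h0 h).trans (le_max_left _ _)
      · have h2 : t = (t - δ) + δ := by ring
        rw [h2, hT.map_add _ _ (sub_nonneg.2 h) hδ.le]
        refine (ContinuousLinearMap.opNorm_comp_le _ _).trans (le_trans ?_ (le_max_right _ _))
        refine mul_le_mul (hC _ (sub_nonneg.2 h) ?_) (hM δ hδ.le le_rfl) (norm_nonneg _) hC0
        push_cast at h1
        linarith
  obtain ⟨n, hn⟩ := exists_nat_ge (a / δ)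
  obtain ⟨C, hC0, hC⟩ := key n
  exact ⟨C, hC0, fun t h0 h1 => hC t h0 (h1.trans ((div_le_iff₀ hδ).1 hn))⟩

/-- Factoring out the semigroup at the smaller of the two times, which is at most `t`, reduces
two-sided continuity at `t` to right continuity at `0`. -/
theorem IsC0Semigroup.continuousOn (hT : IsC0Semigroup T) (x : E) :
    ContinuousOn (fun t => T t x) (Set.Ici 0) := by
  intro t ht
  have ht : 0 ≤ t := ht
  obtain ⟨M, hM0, hM⟩ := hT.exists_bound t
  have key : ∀ s, 0 ≤ s → ‖T s x - T t x‖ ≤ M * ‖T |s - t| x - x‖ := by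
    intro s hs
    rcases le_total s t with h | h
    · have h2 : t = s + (t - s) := by ring
      have h3 : T t x = T s (T (t - s) x) := by
        conv_lhs => rw [h2, hT.map_add _ _ hs (sub_nonneg.2 h)]
        rfl
      rw [abs_sub_comm, abs_of_nonneg (sub_nonneg.2 h), h3, ← map_sub, norm_sub_rev (T _ x) x]
      exact ((T s).le_opNorm _).trans (mul_le_mul_of_nonneg_right (hM s hs h) (norm_nonneg _))
    · have h2 : s = t + (s - t) := by ring
      have h3 : T s x = T t (T (s - t) x) := by
        conv_lhs => rw [h2, hT.map_add _ _ ht (sub_nonneg.2 h)]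
        rfl
      rw [abs_of_nonneg (sub_nonneg.2 h), h3, ← map_sub]
      exact ((T t).le_opNorm _).trans (mul_le_mul_of_nonneg_right (hM t ht le_rfl) (norm_nonneg _))
  have h1 : Tendsto (fun s : ℝ => |s - t|) (𝓝[Set.Ici 0] t) (𝓝[≥] 0) := by
    refine tendsto_nhdsWithin_iff.2 ⟨?_, Eventually.of_forall fun s => Set.mem_Ici.2 (abs_nonneg _)⟩
    have : Continuous fun s : ℝ => |s - t| := by fun_prop
    simpa using (this.tendsto t).mono_left nhdsWithin_le_nhds
  have h2 := (((hT.tendsto_zero_Ici x).comp h1).sub_const x).norm.const_mul M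
  rw [sub_self, norm_zero, mul_zero] at h2
  refine tendsto_iff_norm_sub_tendsto_zero.2 (squeeze_zero' (Eventually.of_forall fun _ =>
    norm_nonneg _) ?_ h2)
  filter_upwards [self_mem_nhdsWithin] with s hs using key s hs

theorem IsC0Semigroup.tendsto_apply (hT : IsC0Semigroup T) {κ : Type*} {l : Filter κ}
    {f : κ → ℝ} {r : ℝ} {y : κ → E} {y₀ : E} (hr : 0 ≤ r) (hf : Tendsto f l (𝓝 r))
    (hf0 : ∀ᶠ i in l, 0 ≤ f i) (hy : Tendsto y l (𝓝 y₀)) :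
    Tendsto (fun i => T (f i) (y i)) l (𝓝 (T r y₀)) := by
  obtain ⟨M, hM0, hM⟩ := hT.exists_bound (r + 1)
  have h1 : Tendsto (fun i => T (f i) y₀) l (𝓝 (T r y₀)) :=
    Tendsto.comp (hT.continuousOn y₀ r hr) (tendsto_nhdsWithin_iff.2 ⟨hf, hf0⟩)
  have h2 : Tendsto (fun i => T (f i) (y i - y₀)) l (𝓝 0) := by
    have h3 := (hy.sub_const y₀).norm.const_mul M
    rw [sub_self, norm_zero, mul_zero] at h3
    refine squeeze_zero_norm' ?_ h3
    filter_upwards [hf0, hf.eventually_le_const (lt_add_one r)] with i hi hi'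
    exact ((T (f i)).le_opNorm _).trans (mul_le_mul_of_nonneg_right (hM _ hi hi') (norm_nonneg _))
  simpa using h2.add h1

theorem IsC0Semigroup.continuousOn_apply_sub (hT : IsC0Semigroup T) {t : ℝ} {g : ℝ → E}
    (hg : ContinuousOn g (Set.Icc 0 t)) :
    ContinuousOn (fun s => T (t - s) (g s)) (Set.Icc 0 t) := by
  intro s hs
  refine hT.tendsto_apply (sub_nonneg.2 hs.2) ?_ ?_ (hg s hs)
  · have : Continuous fun s : ℝ => t - s := by fun_prop
    exact (this.tendsto s).mono_left nhdsWithin_le_nhds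
  · filter_upwards [self_mem_nhdsWithin] with r hr using sub_nonneg.2 hr.2

/-- A classical solution of `h' = A h + g` is the mild solution. -/
theorem Generates.mildState_eq {A : E →ₗ.[ℂ] E} (hA : Generates A T) {h g : ℝ → E}
    (hg : Continuous g)
    (hh : ∀ s, ∃ a, (h s, a) ∈ A.graph ∧ HasDerivAt h (a + g s) s) {t : ℝ} (ht : 0 ≤ t) :
    mildState T (h 0) g t = h t := by
  have hcont : Continuous h := continuous_iff_continuousAt.2 fun s =>
    (hh s).choose_spec.2.continuousAt
  -- For `r > s` the quotient is `T(t - r)` applied to the difference of the quotients of `h` and of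
  -- `T(· - s) h(s)` at `s`; these tend to `a + g s` and `a`. Only right derivatives are available
  -- from the generator, and they suffice for the fundamental theorem of calculus.
  have hderiv : ∀ s ∈ Set.Ioo 0 t,
      HasDerivWithinAt (fun s => T (t - s) (h s)) (T (t - s) (g s)) (Set.Ioi s) s := by
    intro s hs
    obtain ⟨a, ha, hd⟩ := hh s
    rw [hasDerivWithinAt_iff_tendsto_slope' (Set.self_notMem_Ioi)]
    have h1 := (hasDerivWithinAt_iff_tendsto_slope' (Set.self_notMem_Ioi)).1
      (hd.hasDerivWithinAt (s := Set.Ioi s))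
    have hsub : Tendsto (fun r : ℝ => r - s) (𝓝[>] s) (𝓝[>] 0) := by
      refine tendsto_nhdsWithin_iff.2 ⟨?_, ?_⟩
      · have : Continuous fun r : ℝ => r - s := by fun_prop
        simpa using (this.tendsto s).mono_left nhdsWithin_le_nhds
      · filter_upwards [self_mem_nhdsWithin] with r hr using sub_pos.2 (Set.mem_Ioi.1 hr)
    have h2 := h1.sub (((hA.2 _ _).1 ha).comp hsub)
    rw [add_sub_cancel_left] at h2
    have h3 : Tendsto (fun r : ℝ => t - r) (𝓝[>] s) (𝓝 (t - s)) := by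
      have : Continuous fun r : ℝ => t - r := by fun_prop
      exact (this.tendsto s).mono_left nhdsWithin_le_nhds
    have h4 : ∀ᶠ r in 𝓝[>] s, 0 ≤ t - r := by
      filter_upwards [Ioo_mem_nhdsGT hs.2] with r hr using sub_nonneg.2 hr.2.le
    refine (hA.1.tendsto_apply (sub_nonneg.2 hs.2.le) h3 h4 h2).congr' ?_
    filter_upwards [h4, self_mem_nhdsWithin] with r hr hrs
    have h5 : T (t - s) (h s) = T (t - r) (T (r - s) (h s)) := by
      rw [← ContinuousLinearMap.comp_apply, ← hA.1.map_add _ _ hr (sub_nonneg.2 (le_of_lt hrs))]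
      congr 2
      ring
    have h6 : ((r - s : ℝ) : ℂ)⁻¹ = (((r - s)⁻¹ : ℝ) : ℂ) := by push_cast; rfl
    simp only [slope_def_module, Function.comp, h5, h6, Complex.coe_smul]
    rw [← smul_sub, ← Complex.coe_smul, map_smul, Complex.coe_smul]
    congr 1
    simp only [map_sub]
    abel
  have hint := intervalIntegral.integral_eq_sub_of_hasDeriv_right_of_le ht
    (hA.1.continuousOn_apply_sub hcont.continuousOn) hderiv
    ((hA.1.continuousOn_apply_sub hg.continuousOn).intervalIntegrable_of_Icc ht)
  rw [mildState, hint]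
  simp [hA.1.map_zero]

/-- The averages `r⁻¹ ∫₀ʳ T s x ds` lie in the domain and tend to `x`. -/
theorem Generates.dense_domain {A : E →ₗ.[ℂ] E} (hA : Generates A T) :
    Dense (A.domain : Set E) := by
  intro x
  have hc := hA.1.continuousOn x
  have hint : ∀ a b, 0 ≤ a → 0 ≤ b → IntervalIntegrable (fun s => T s x) MeasureTheory.volume a b :=
    fun a b ha hb => (hc.mono fun s hs => (le_min ha hb).trans hs.1).intervalIntegrable
  have hright : ∀ a, 0 ≤ a → Tendsto (fun r : ℝ => (r : ℂ)⁻¹ • ∫ s in a..(a + r), T s x)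
      (𝓝[>] 0) (𝓝 (T a x)) := by
    intro a ha
    have hca : ContinuousWithinAt (fun s => T s x) (Set.Ioi a) a :=
      (hc a ha).mono fun s hs => ha.trans (le_of_lt hs)
    have hd : HasDerivWithinAt (fun u => ∫ s in a..u, T s x) (T a x) (Set.Ici a) a := by
      refine intervalIntegral.integral_hasDerivWithinAt_right (hint a a ha ha) ?_ hca
      exact ⟨Set.Ioi a, self_mem_nhdsWithin,
        (hc.mono fun s hs => ha.trans (le_of_lt hs)).aestronglyMeasurable measurableSet_Ioi⟩
    have h1 := (hasDerivWithinAt_iff_tendsto_slope' (Set.self_notMem_Ioi)).1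
      (hd.mono Set.Ioi_subset_Ici_self)
    have hadd : Tendsto (fun r : ℝ => a + r) (𝓝[>] 0) (𝓝[>] a) := by
      refine tendsto_nhdsWithin_iff.2 ⟨?_, ?_⟩
      · have : Continuous fun r : ℝ => a + r := by fun_prop
        simpa using (this.tendsto 0).mono_left nhdsWithin_le_nhds
      · filter_upwards [self_mem_nhdsWithin] with r hr using lt_add_of_pos_right a hr
    refine (h1.comp hadd).congr fun r => ?_
    simp only [slope_def_module, Function.comp, intervalIntegral.integral_same, sub_zero,
      add_sub_cancel_left]
    rw [← Complex.coe_smul]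
    push_cast
    rfl
  -- Applying `T r` shifts the interval of integration, so the difference quotient is the average
  -- over `[δ, δ + r]` minus the one over `[0, r]`.
  have hmem : ∀ δ : ℝ, 0 < δ → (∫ s in (0 : ℝ)..δ, T s x) ∈ A.domain := by
    intro δ hδ
    refine LinearPMap.mem_domain_of_mem_graph ((hA.2 _ (T δ x - T 0 x)).2 ?_)
    refine ((hright δ hδ.le).sub (hright 0 le_rfl)).congr' ?_
    filter_upwards [self_mem_nhdsWithin] with r hr
    have hr : 0 < r := hr
    have h1 : T r (∫ s in (0 : ℝ)..δ, T s x) = ∫ s in r..(δ + r), T s x := by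
      rw [← ContinuousLinearMap.intervalIntegral_comp_comm _ (hint 0 δ le_rfl hδ.le)]
      have h2 := intervalIntegral.integral_comp_add_right (a := 0) (b := δ) (fun s => T s x) r
      rw [zero_add] at h2
      rw [← h2]
      refine intervalIntegral.integral_congr fun s hs => ?_
      rw [Set.uIcc_of_le hδ.le] at hs
      rw [add_comm, hA.1.map_add _ _ hr.le hs.1]
      rfl
    rw [h1, ← smul_sub, zero_add]
    congr 1
    rw [← intervalIntegral.integral_add_adjacent_intervals (hint r δ hr.le hδ.le)
      (hint δ (δ + r) hδ.le (by positivity)),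
      ← intervalIntegral.integral_add_adjacent_intervals (hint 0 r le_rfl hr.le)
      (hint r δ hr.le hδ.le)]
    abel
  have h0 := hright 0 le_rfl
  rw [hA.1.map_zero] at h0
  refine mem_closure_of_tendsto h0 ?_
  filter_upwards [self_mem_nhdsWithin] with r hr
  rw [zero_add]
  exact A.domain.smul_mem _ (hmem r hr)

end Semigroup

/-! ### Extrapolation spaces and the closed-loop operators -/

section Extrapolation

variable {X : Type*} [NormedAddCommGroup X] [NormedSpace ℂ X]

theorem mem_shift_graph {A : X →ₗ.[ℂ] X} {μ : ℂ} {x y : X} :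
    (x, y) ∈ (shift A μ).graph ↔ (x, μ • x - y) ∈ A.graph := by
  simp only [LinearPMap.mem_graph_iff]
  constructor
  · rintro ⟨z, rfl, h⟩
    refine ⟨z, rfl, ?_⟩
    have h2 : μ • (z : X) - A z = y := h
    rw [← h2, sub_sub_cancel]
  · rintro ⟨z, rfl, h⟩
    refine ⟨z, rfl, ?_⟩
    change μ • (z : X) - A z = y
    rw [h, sub_sub_cancel]

theorem mem_ran_shift {A : X →ₗ.[ℂ] X} {μ : ℂ} {y : X} :
    y ∈ ran (shift A μ) ↔ ∃ x w, (x, w) ∈ A.graph ∧ μ • x - w = y := by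
  constructor
  · rintro ⟨x, rfl⟩
    exact ⟨x, A x, LinearPMap.mem_graph A x, rfl⟩
  · rintro ⟨x, w, h, rfl⟩
    obtain ⟨z, rfl, rfl⟩ := (LinearPMap.mem_graph_iff A).1 h
    exact ⟨z, rfl⟩

theorem continuous_embed (A : X →ₗ.[ℂ] X) (μ : ℂ) : Continuous (embed A μ) :=
  AddMonoidHomClass.continuous_of_bound _ ‖res A μ‖ fun x => by
    rw [norm_embed]
    exact (res A μ).le_opNorm x

theorem denseRange_embed (A : X →ₗ.[ℂ] X) (μ : ℂ) : DenseRange (embed A μ) :=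
  UniformSpace.Completion.denseRange_coe.comp (toPreExtrap A μ).surjective.denseRange
    (UniformSpace.Completion.continuous_coe _)

theorem extRes_embed [CompleteSpace X] (A : X →ₗ.[ℂ] X) (μ : ℂ) (x : X) :
    extRes A μ μ (embed A μ x) = res A μ x :=
  LinearMap.extendOfNorm_eq (f := (res A μ).toLinearMap) (denseRange_embed A μ)
    ⟨1, fun x => by rw [norm_embed, one_mul]; rfl⟩ x

/-- The identity `R(μ, A) A = μ R(μ, A) - 1` on the domain makes `A` bounded from the norm of `X` to
that of `X₋₁`, so the extension by density agrees with `A`. -/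
theorem extOp_apply {A : X →ₗ.[ℂ] X} (hA : Dense (A.domain : Set X)) {μ : ℂ} (hμ : μ ∈ rho A)
    {x y : X} (h : (x, y) ∈ A.graph) : extOp A μ x = embed A μ y := by
  obtain ⟨z, rfl, rfl⟩ := (LinearPMap.mem_graph_iff A).1 h
  refine LinearMap.extendOfNorm_eq (f := (embed A μ).comp A.toFun) (e := A.domain.subtype)
    (by simpa [DenseRange] using hA) ⟨‖μ‖ * ‖res A μ‖ + 1, fun x => ?_⟩ z
  have h1 : res A μ (μ • (x : X) - A x) = x := (res_spec hμ).2 x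
  have h2 : res A μ (A x) = μ • res A μ x - x := by
    rw [map_sub, map_smul] at h1
    exact (sub_eq_of_eq_add (sub_eq_iff_eq_add'.1 h1)).symm
  change ‖embed A μ (A x)‖ ≤ _ * ‖(x : X)‖
  rw [norm_embed, h2, add_mul, one_mul]
  refine (norm_sub_le _ _).trans (add_le_add ?_ le_rfl)
  rw [norm_smul, mul_assoc]
  exact mul_le_mul_of_nonneg_left ((res A μ).le_opNorm _) (norm_nonneg _)

/-- This is `(μ - A₋₁) R(μ, A₋₁) = 1`: it holds on the dense subspace `X`, and both sides are
continuous on `X₋₁`. -/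
theorem extOp_extRes [CompleteSpace X] {A : X →ₗ.[ℂ] X} (hA : Dense (A.domain : Set X)) {μ : ℂ}
    (hμ : μ ∈ rho A) (b : Extrap A μ) :
    extOp A μ (extRes A μ μ b) + b = embed A μ (μ • extRes A μ μ b) := by
  refine (denseRange_embed A μ).induction_on (p := fun b => extOp A μ (extRes A μ μ b) + b =
    embed A μ (μ • extRes A μ μ b)) b ?_ fun x => ?_
  · exact isClosed_eq (by fun_prop) ((continuous_embed A μ).comp (by fun_prop))
  · rw [extRes_embed, extOp_apply hA hμ (mem_shift_graph.1 ((res_spec hμ).1 x)), map_sub,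
      sub_add_cancel]

end Extrapolation

/-! ### Graphs of the closed-loop operators. -/

section ClosedLoop

variable {X U Y Z : Type*} [NormedAddCommGroup X] [NormedSpace ℂ X] [CompleteSpace X]
  [NormedAddCommGroup U] [NormedSpace ℂ U] [NormedAddCommGroup Y] [NormedSpace ℂ Y]
  [NormedAddCommGroup Z] [NormedSpace ℂ Z] {P : Plant X U Y} {G : Controller Y Z U}

theorem mem_Ce_graph {x : X × Z} {c : Y} : (x, c) ∈ (Ce P G).graph ↔
    ∃ y u, (x.1, y) ∈ P.C.graph ∧ (x.2, u) ∈ G.K.graph ∧ c = y + P.D u := by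
  obtain ⟨x, z⟩ := x
  constructor
  · intro h
    obtain ⟨⟨⟨x', z'⟩, hx, hz⟩, h1, rfl⟩ := (LinearPMap.mem_graph_iff _).1 h
    obtain ⟨rfl, rfl⟩ := Prod.mk.inj h1
    exact ⟨_, _, LinearPMap.mem_graph P.C ⟨x', hx⟩, LinearPMap.mem_graph G.K ⟨z', hz⟩, rfl⟩
  · rintro ⟨y, u, h1, h2, rfl⟩
    obtain ⟨⟨x', hx⟩, h3, rfl⟩ := (LinearPMap.mem_graph_iff _).1 h1
    obtain ⟨⟨z', hz⟩, h4, rfl⟩ := (LinearPMap.mem_graph_iff _).1 h2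
    dsimp only at h3 h4
    subst h3 h4
    exact (LinearPMap.mem_graph_iff _).2 ⟨⟨(x', z'), hx, hz⟩, rfl, rfl⟩

/-- Extracts the controller row, where `G₂ C x + G₂ D K z` is collected into `G₂ C_e`; sufficiency
uses nothing else about `A_e` on the chains. -/
theorem exists_of_mem_Ae_graph {x a : X × Z} (h : (x, a) ∈ (Ae P G).graph) :
    ∃ c w, (x, c) ∈ (Ce P G).graph ∧ (x.2, w) ∈ G.G₁.graph ∧ a.2 = w + G.G₂ c := by
  rw [Ae_graph] at h
  obtain ⟨y, u, w, h1, h2, h3, -, h5⟩ := h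
  refine ⟨y + P.D u, w, mem_Ce_graph.2 ⟨y, u, h1, h3, rfl⟩, h2, ?_⟩
  rw [h5, map_add]
  abel

/-- Every element of `Dom(G₁)` is the second component of an element of `Dom(A_e)`. -/
theorem exists_mem_Ae_graph {z w : Z} (h : (z, w) ∈ G.G₁.graph) :
    ∃ x x' c, ((x, z), c) ∈ (Ce P G).graph ∧ ((x, z), (x', w + G.G₂ c)) ∈ (Ae P G).graph := by
  obtain ⟨T, hT⟩ := P.generates
  obtain ⟨M, hM⟩ := P.CRB_bounded
  obtain ⟨μ, -, hK, -⟩ := G.K_bounded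
  obtain ⟨u, hu⟩ := LinearPMap.mem_domain_iff.1 (hK (LinearPMap.mem_domain_of_mem_graph h))
  -- With `x = R(lam, A₋₁) B K z` one has `A₋₁ x + B K z = lam x`, which lies in `X`, and `C x` is
  -- defined by the assumption on `C R(lam, A₋₁) B`.
  refine ⟨extRes P.A P.lam P.lam (P.B u), P.lam • extRes P.A P.lam P.lam (P.B u), M u + P.D u,
    mem_Ce_graph.2 ⟨_, _, hM u, hu, rfl⟩, ?_⟩
  rw [Ae_graph]
  refine ⟨M u, u, w, hM u, h, hu, extOp_extRes hT.dense_domain P.lam_mem _, ?_⟩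
  simp only [map_add]
  abel

end ClosedLoop

/-! ### The exosystem -/

/-- The coefficients `exp(μ t) t^m / m!` of the exponential of a Jordan block. -/
def chainCoeff (μ : ℂ) (m : ℕ) (t : ℝ) : ℂ :=
  Complex.exp (μ * t) * ((t : ℂ) ^ m / (m.factorial : ℂ))

theorem hasDerivAt_chainCoeff (μ : ℂ) (m : ℕ) (t : ℝ) : HasDerivAt (chainCoeff μ m)
    (μ * chainCoeff μ m t + if m = 0 then 0 else chainCoeff μ (m - 1) t) t := by
  have h1 : HasDerivAt (fun t : ℝ => Complex.exp (μ * t)) (Complex.exp (μ * t) * (μ * 1)) t :=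
    ((Complex.ofRealCLM.hasDerivAt (x := t)).const_mul μ).cexp
  have h2 : HasDerivAt (fun t : ℝ => (t : ℂ) ^ m / (m.factorial : ℂ))
      (if m = 0 then 0 else (t : ℂ) ^ (m - 1) / ((m - 1).factorial : ℂ)) t := by
    cases m with
    | zero => simpa using hasDerivAt_const t (1 : ℂ)
    | succ m =>
      have h3 := ((Complex.ofRealCLM.hasDerivAt (x := t)).pow (m + 1)).div_const
        ((m + 1).factorial : ℂ)
      have h4 : ((m : ℂ) + 1) ≠ 0 := by exact_mod_cast Nat.succ_ne_zero m
      have h5 : (m.factorial : ℂ) ≠ 0 := by exact_mod_cast Nat.factorial_ne_zero m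
      refine h3.congr_deriv ?_
      simp [Nat.factorial_succ]
      field_simp
  refine (h1.mul h2).congr_deriv ?_
  simp only [chainCoeff]
  split_ifs <;> ring

theorem continuous_chainCoeff (μ : ℂ) (m : ℕ) : Continuous (chainCoeff μ m) := by
  unfold chainCoeff
  fun_prop

theorem chainCoeff_at_zero (μ : ℂ) (m : ℕ) : chainCoeff μ m 0 = if m = 0 then 1 else 0 := by
  by_cases h : m = 0 <;> simp [chainCoeff, h]

namespace Exosystem

variable {ι W : Type*} [NormedAddCommGroup W] [InnerProductSpace ℂ W]

/-- The span of the `k`-th Jordan chain. -/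
def blockSpace (S : Exosystem ι W) (k : ι) : Submodule ℂ W :=
  Submodule.span ℂ (Set.range fun l => S.φ ⟨k, l⟩)

/-- The `k`-th term of the series defining the flow. -/
def flowBlock (S : Exosystem ι W) (k : ι) (t : ℝ) : W →ₗ[ℂ] W :=
  Complex.exp (S.freq k * t) • ∑ l, (S.coeff k l).smulRight
    (∑ j ∈ Finset.univ.filter (fun j => j ≤ l),
      ((t : ℂ) ^ ((l : ℕ) - (j : ℕ)) / (Nat.factorial ((l : ℕ) - (j : ℕ)) : ℂ)) • S.φ ⟨k, j⟩)

variable (S : Exosystem ι W)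

theorem coeff_apply (k : ι) (l : Fin (S.n k)) (v : W) : S.coeff k l v = inner ℂ (S.φ ⟨k, l⟩) v :=
  rfl

theorem proj_apply (k : ι) (v : W) : S.proj k v = ∑ l, S.coeff k l v • S.φ ⟨k, l⟩ := by
  simp [proj]

theorem block_apply (k : ι) (v : W) :
    S.block k v = ∑ l, S.coeff k l v • (S.freq k • S.φ ⟨k, l⟩ + S.pred k l) := by
  simp [block]

theorem flowBlock_apply (k : ι) (t : ℝ) (v : W) : S.flowBlock k t v =
    Complex.exp (S.freq k * t) • ∑ l, S.coeff k l v •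
      ∑ j ∈ Finset.univ.filter (fun j => j ≤ l),
        ((t : ℂ) ^ ((l : ℕ) - (j : ℕ)) / (Nat.factorial ((l : ℕ) - (j : ℕ)) : ℂ)) •
          S.φ ⟨k, j⟩ := by
  simp [flowBlock]

theorem flow_eq (t : ℝ) (v : W) : S.flow t v = ∑' k, S.flowBlock k t v := by
  simp only [flowBlock_apply]
  rfl

theorem coeff_basis_self (k : ι) (l : Fin (S.n k)) : S.coeff k l (S.φ ⟨k, l⟩) = 1 := by
  rw [coeff_apply, inner_self_eq_norm_sq_to_K, S.φ.orthonormal.1]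
  simp

theorem coeff_basis_of_ne {k : ι} {l l' : Fin (S.n k)} (h : l ≠ l') :
    S.coeff k l (S.φ ⟨k, l'⟩) = 0 :=
  S.φ.orthonormal.2 fun h' => h (by simpa using h')

theorem basis_mem_blockSpace (k : ι) (l : Fin (S.n k)) : S.φ ⟨k, l⟩ ∈ S.blockSpace k :=
  Submodule.subset_span ⟨l, rfl⟩

theorem pred_mem_blockSpace (k : ι) (l : Fin (S.n k)) : S.pred k l ∈ S.blockSpace k := by
  unfold pred
  split_ifs
  · exact Submodule.zero_mem _
  · exact S.basis_mem_blockSpace _ _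

theorem norm_pred_le (k : ι) (l : Fin (S.n k)) : ‖S.pred k l‖ ≤ 1 := by
  unfold pred
  split_ifs
  · simp
  · exact (S.φ.orthonormal.1 _).le

theorem proj_mem_blockSpace (k : ι) (v : W) : S.proj k v ∈ S.blockSpace k := by
  rw [proj_apply]
  exact Submodule.sum_mem _ fun l _ => Submodule.smul_mem _ _ (S.basis_mem_blockSpace k l)

theorem block_mem_blockSpace (k : ι) (v : W) : S.block k v ∈ S.blockSpace k := by
  rw [block_apply]
  exact Submodule.sum_mem _ fun l _ => Submodule.smul_mem _ _ (Submodule.add_mem _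
    (Submodule.smul_mem _ _ (S.basis_mem_blockSpace k l)) (S.pred_mem_blockSpace k l))

theorem flowBlock_mem_blockSpace (k : ι) (t : ℝ) (v : W) :
    S.flowBlock k t v ∈ S.blockSpace k := by
  rw [flowBlock_apply]
  exact Submodule.smul_mem _ _ (Submodule.sum_mem _ fun l _ => Submodule.smul_mem _ _
    (Submodule.sum_mem _ fun j _ => Submodule.smul_mem _ _ (S.basis_mem_blockSpace k j)))

/-- The `j`-th vector of the `k`-th Jordan chain, and `0` if there is none. -/
def chain (k : ι) (j : ℕ) : W := if h : j < S.n k then S.φ ⟨k, ⟨j, h⟩⟩ else 0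

theorem chain_mem_blockSpace (k : ι) (j : ℕ) : S.chain k j ∈ S.blockSpace k := by
  unfold chain
  split_ifs
  · exact S.basis_mem_blockSpace _ _
  · exact Submodule.zero_mem _

theorem chain_coe (k : ι) (l : Fin (S.n k)) : S.chain k l = S.φ ⟨k, l⟩ := by
  simp [chain]

theorem orthogonalFamily : OrthogonalFamily ℂ (fun k => S.blockSpace k)
    fun k => (S.blockSpace k).subtypeₗᵢ := by
  refine OrthogonalFamily.of_pairwise fun k k' hk => ?_
  refine Submodule.isOrtho_span.2 ?_
  rintro _ ⟨l, rfl⟩ _ ⟨l', rfl⟩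
  exact S.φ.orthonormal.2 fun h => hk (congrArg Sigma.fst h)

theorem coeff_eq_zero_of_mem {k k' : ι} (h : k ≠ k') (l : Fin (S.n k)) {x : W}
    (hx : x ∈ S.blockSpace k') : S.coeff k l x = 0 :=
  (S.orthogonalFamily.isOrtho h).inner_eq (S.basis_mem_blockSpace k l) hx

theorem proj_eq_zero_of_mem {k k' : ι} (h : k ≠ k') {x : W} (hx : x ∈ S.blockSpace k') :
    S.proj k x = 0 := by
  simp [proj_apply, S.coeff_eq_zero_of_mem h _ hx]

theorem proj_basis (k : ι) (l : Fin (S.n k)) : S.proj k (S.φ ⟨k, l⟩) = S.φ ⟨k, l⟩ := by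
  rw [proj_apply, Finset.sum_eq_single l]
  · rw [coeff_basis_self, one_smul]
  · intro l' _ h
    rw [S.coeff_basis_of_ne h, zero_smul]
  · simp

theorem proj_eq_self_of_mem {k : ι} {x : W} (hx : x ∈ S.blockSpace k) : S.proj k x = x := by
  have h : S.blockSpace k ≤ LinearMap.eqLocus (S.proj k) LinearMap.id := by
    refine Submodule.span_le.2 ?_
    rintro _ ⟨l, rfl⟩
    exact S.proj_basis k l
  exact h hx

theorem coeff_proj (k : ι) (l : Fin (S.n k)) (v : W) :
    S.coeff k l (S.proj k v) = S.coeff k l v := by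
  rw [proj_apply, map_sum, Finset.sum_eq_single l]
  · rw [map_smul, coeff_basis_self, smul_eq_mul, mul_one]
  · intro l' _ h
    rw [map_smul, S.coeff_basis_of_ne h.symm, smul_zero]
  · simp

theorem continuous_coeff (k : ι) (l : Fin (S.n k)) : Continuous (S.coeff k l) :=
  (innerSL ℂ (S.φ ⟨k, l⟩)).continuous

theorem continuous_proj (k : ι) : Continuous (S.proj k) := by
  have h : (S.proj k : W → W) = fun v => ∑ l, S.coeff k l v • S.φ ⟨k, l⟩ :=
    funext (S.proj_apply k)
  rw [h]
  exact continuous_finsetSum _ fun l _ => (S.continuous_coeff k l).smul continuous_const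

theorem norm_coeff_le (k : ι) (l : Fin (S.n k)) (v : W) : ‖S.coeff k l v‖ ≤ ‖S.proj k v‖ := by
  rw [← coeff_proj, coeff_apply]
  simpa [S.φ.orthonormal.1] using norm_inner_le_norm (𝕜 := ℂ) (S.φ ⟨k, l⟩) (S.proj k v)

theorem hasSum_proj (v : W) : HasSum (fun k => S.proj k v) v := by
  refine (S.φ.hasSum_repr v).sigma fun k => ?_
  have h := hasSum_fintype fun l => S.coeff k l v • S.φ ⟨k, l⟩
  rw [← proj_apply] at h
  simpa [S.φ.repr_apply_apply, coeff_apply] using h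

theorem hasSum_norm_proj_sq (v : W) : HasSum (fun k => ‖S.proj k v‖ ^ 2) (‖v‖ ^ 2) := by
  have h : Tendsto (fun s : Finset ι => ‖∑ k ∈ s, S.proj k v‖ ^ 2) atTop (𝓝 (‖v‖ ^ 2)) :=
    Tendsto.pow (Tendsto.norm (S.hasSum_proj v)) 2
  refine h.congr fun s => ?_
  exact S.orthogonalFamily.norm_sum (fun k => ⟨S.proj k v, S.proj_mem_blockSpace k v⟩) s

/-- Orthogonality of the blocks turns square summability into summability. It gives meaning to the
series for both `S` and its flow. -/
theorem hasSum_of_mem_blockSpace [CompleteSpace W] {f : ι → W}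
    (hf : ∀ k, f k ∈ S.blockSpace k) (hs : Summable fun k => ‖f k‖ ^ 2) :
    ∃ w, HasSum f w ∧ ∀ k, S.proj k w = f k := by
  have h1 : Summable f := (S.orthogonalFamily.summable_iff_norm_sq_summable
    fun k => ⟨f k, hf k⟩).2 hs
  refine ⟨∑' k, f k, h1.hasSum, fun k => ?_⟩
  have h2 : HasSum (fun k' => S.proj k (f k')) (S.proj k (∑' k, f k)) :=
    h1.hasSum.map (S.proj k) (S.continuous_proj k)
  refine h2.unique ?_
  have h3 := hasSum_single (f := fun k' => S.proj k (f k')) k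
    fun k' hk => S.proj_eq_zero_of_mem hk.symm (hf k')
  simpa [S.proj_eq_self_of_mem (hf k)] using h3

/-! #### The scale spaces -/

theorem one_le_weight (k : ι) : 1 ≤ 1 + S.ω k ^ 2 := le_add_of_nonneg_right (sq_nonneg _)

theorem mem_scale {α : ℝ} {v : W} :
    v ∈ S.scale α ↔ Summable fun k => (1 + S.ω k ^ 2) ^ α * ‖S.proj k v‖ ^ 2 := Iff.rfl

theorem scaleNorm_nonneg (α : ℝ) (v : W) : 0 ≤ S.scaleNorm α v := Real.sqrt_nonneg _

/-- Reduces the mapping properties of inclusions, of `S` and of the flow between scale spaces to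
blockwise estimates uniform in `k`. -/
theorem mem_scale_and_scaleNorm_le {α β C : ℝ} (hC : 0 ≤ C) {v w : W} (hv : v ∈ S.scale β)
    (h : ∀ k, (1 + S.ω k ^ 2) ^ α * ‖S.proj k w‖ ^ 2 ≤
      C ^ 2 * ((1 + S.ω k ^ 2) ^ β * ‖S.proj k v‖ ^ 2)) :
    w ∈ S.scale α ∧ S.scaleNorm α w ≤ C * S.scaleNorm β v := by
  have hs := Summable.mul_left (C ^ 2) (S.mem_scale.1 hv)
  have hw : w ∈ S.scale α := Summable.of_nonneg_of_le (fun k => by positivity) h hs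
  refine ⟨hw, ?_⟩
  have h1 := (S.mem_scale.1 hw).tsum_le_tsum h hs
  rw [tsum_mul_left] at h1
  have h2 := Real.sqrt_le_sqrt h1
  rwa [Real.sqrt_mul (sq_nonneg C), Real.sqrt_sq hC] at h2

theorem scale_mono {α β : ℝ} (h : α ≤ β) {v : W} (hv : v ∈ S.scale β) :
    v ∈ S.scale α ∧ S.scaleNorm α v ≤ S.scaleNorm β v := by
  have := S.mem_scale_and_scaleNorm_le (α := α) (w := v) zero_le_one hv fun k => by
    rw [one_pow, one_mul]
    exact mul_le_mul_of_nonneg_right (Real.rpow_le_rpow_of_exponent_le (S.one_le_weight k) h)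
      (sq_nonneg _)
  simpa using this

theorem mem_scale_zero (v : W) : v ∈ S.scale 0 := by
  simpa [mem_scale] using (S.hasSum_norm_proj_sq v).summable

theorem scaleNorm_zero (v : W) : S.scaleNorm 0 v = ‖v‖ := by
  simp [scaleNorm, (S.hasSum_norm_proj_sq v).tsum_eq]

theorem norm_le_scaleNorm {α : ℝ} (hα : 0 ≤ α) {v : W} (hv : v ∈ S.scale α) :
    ‖v‖ ≤ S.scaleNorm α v := by
  simpa [scaleNorm_zero] using (S.scale_mono hα hv).2

theorem mem_scale_of_mem_blockSpace (α : ℝ) {k : ι} {x : W} (hx : x ∈ S.blockSpace k) :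
    x ∈ S.scale α := by
  refine summable_of_ne_finset_zero (s := {k}) fun k' hk' => ?_
  simp [S.proj_eq_zero_of_mem (by simpa using hk') hx]

/-- The truncations `∑_{k ∈ s} P_k v` converge to `v` in `W_α`. -/
theorem tendsto_scaleNorm_sub (α : ℝ) (v : W) :
    Tendsto (fun s : Finset ι => S.scaleNorm α (v - ∑ k ∈ s, S.proj k v)) atTop (𝓝 0) := by
  classical
  have hproj : ∀ (s : Finset ι) k, S.proj k (v - ∑ k ∈ s, S.proj k v) =
      if k ∈ s then 0 else S.proj k v := by
    intro s k
    rw [map_sub, map_sum]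
    have : ∀ k' ∈ s, S.proj k (S.proj k' v) = if k = k' then S.proj k v else 0 := by
      intro k' _
      split_ifs with h
      · subst h
        exact S.proj_eq_self_of_mem (S.proj_mem_blockSpace k v)
      · exact S.proj_eq_zero_of_mem h (S.proj_mem_blockSpace k' v)
    rw [Finset.sum_congr rfl this, Finset.sum_ite_eq]
    split_ifs <;> simp
  have h1 := tendsto_tsum_compl_atTop_zero
    fun k => (1 + S.ω k ^ 2) ^ α * ‖S.proj k v‖ ^ 2
  have h2 := (Real.continuous_sqrt.tendsto 0).comp h1
  rw [Real.sqrt_zero] at h2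
  refine h2.congr fun s => ?_
  rw [scaleNorm, Function.comp]
  congr 1
  refine (tsum_subtype {k | k ∉ s}
    fun k => (1 + S.ω k ^ 2) ^ α * ‖S.proj k v‖ ^ 2).trans ?_
  refine tsum_congr fun k => ?_
  rw [hproj]
  by_cases hk : k ∈ s <;> simp [hk]

/-- The vectors of the Jordan chains as elements of `W_α`. -/
def scaleChain (α : ℝ) (k : ι) (j : ℕ) : S.scale α :=
  ⟨S.chain k j, S.mem_scale_of_mem_blockSpace α (S.chain_mem_blockSpace k j)⟩

/-- Finite truncations of `v` are combinations of chain vectors, so `‖M v‖` is at most `c` times the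
norm of the remainder, which tends to `0` in `W_α`. Identities on Jordan chains are extended to the
scale spaces in this way. -/
theorem eq_zero_of_chain {α : ℝ} {Y : Type*} [NormedAddCommGroup Y] [NormedSpace ℂ Y]
    (M : S.scale α →ₗ[ℂ] Y) {c : ℝ} (hM : ∀ v, ‖M v‖ ≤ c * S.scaleNorm α v)
    (h : ∀ k, ∀ j < S.n k, M (S.scaleChain α k j) = 0) (v : S.scale α) : M v = 0 := by
  let p : ι → S.scale α := fun k =>
    ⟨S.proj k v, S.mem_scale_of_mem_blockSpace α (S.proj_mem_blockSpace k v)⟩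
  have hp : ∀ k, M (p k) = 0 := by
    intro k
    have : p k = ∑ l, S.coeff k l v • S.scaleChain α k l := by
      apply Subtype.ext
      simp [p, proj_apply, scaleChain, chain_coe]
    simp [this, h]
  have h1 : ∀ s : Finset ι, ‖M v‖ ≤ c * S.scaleNorm α (v - ∑ k ∈ s, S.proj k v) := by
    intro s
    have h2 := hM (v - ∑ k ∈ s, p k)
    rw [map_sub, map_sum, Finset.sum_eq_zero fun k _ => hp k, sub_zero] at h2
    simpa [p] using h2
  have h3 := (S.tendsto_scaleNorm_sub α v).const_mul c
  rw [mul_zero] at h3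
  exact norm_le_zero_iff.1 (ge_of_tendsto' h3 h1)

/-! #### The system operator -/

theorem norm_block_le {N : ℕ} (hN : ∀ k, S.n k ≤ N) (k : ι) (v : W) :
    ‖S.block k v‖ ≤ (|S.ω k| + N) * ‖S.proj k v‖ := by
  have h1 : S.block k v = S.freq k • S.proj k v + ∑ l, S.coeff k l v • S.pred k l := by
    rw [block_apply, proj_apply, Finset.smul_sum, ← Finset.sum_add_distrib]
    refine Finset.sum_congr rfl fun l _ => ?_
    rw [smul_add, smul_comm]
  have h2 : ‖S.freq k‖ = |S.ω k| := by simp [freq]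
  rw [h1, add_mul]
  refine (norm_add_le _ _).trans (add_le_add ?_ ?_)
  · rw [norm_smul, h2]
  · refine (norm_sum_le _ _).trans ?_
    have h3 : ∀ l ∈ (Finset.univ : Finset (Fin (S.n k))),
        ‖S.coeff k l v • S.pred k l‖ ≤ ‖S.proj k v‖ := by
      intro l _
      rw [norm_smul]
      exact (mul_le_of_le_one_right (norm_nonneg _) (S.norm_pred_le k l)).trans
        (S.norm_coeff_le k l v)
    refine (Finset.sum_le_card_nsmul _ _ _ h3).trans ?_
    rw [Finset.card_univ, Fintype.card_fin, nsmul_eq_mul]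
    exact mul_le_mul_of_nonneg_right (by exact_mod_cast hN k) (norm_nonneg _)

/-- `S_k` grows like `|ω_k|` up to a bounded nilpotent part, so `S` costs one order of the scale;
the uniform bound on block sizes makes the constant independent of `k`. -/
theorem weight_mul_norm_block_sq_le {N : ℕ} (hN : ∀ k, S.n k ≤ N) (α : ℝ) (k : ι) (v : W) :
    (1 + S.ω k ^ 2) ^ α * ‖S.block k v‖ ^ 2 ≤
      (1 + N : ℝ) ^ 2 * ((1 + S.ω k ^ 2) ^ (α + 1) * ‖S.proj k v‖ ^ 2) := by
  have h0 : (0 : ℝ) < 1 + S.ω k ^ 2 := by positivity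
  have h1 : ‖S.block k v‖ ^ 2 ≤ ((|S.ω k| + N) * ‖S.proj k v‖) ^ 2 :=
    pow_le_pow_left₀ (norm_nonneg _) (S.norm_block_le hN k v) 2
  have h2 : (|S.ω k| + N) ^ 2 ≤ (1 + N : ℝ) ^ 2 * (1 + S.ω k ^ 2) := by
    have hN0 : (0 : ℝ) ≤ N := Nat.cast_nonneg N
    have h4 : |S.ω k| ^ 2 = S.ω k ^ 2 := sq_abs _
    nlinarith [sq_nonneg (|S.ω k| - 1), mul_nonneg hN0 (sq_nonneg (|S.ω k| - 1)),
      mul_nonneg hN0 hN0, mul_nonneg (mul_nonneg hN0 hN0) (sq_nonneg (S.ω k)),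
      mul_nonneg hN0 (sq_nonneg (S.ω k)), sq_nonneg (S.ω k)]
  rw [Real.rpow_add h0, Real.rpow_one]
  calc _ ≤ (1 + S.ω k ^ 2) ^ α * ((1 + N : ℝ) ^ 2 * (1 + S.ω k ^ 2) * ‖S.proj k v‖ ^ 2) := by
        refine mul_le_mul_of_nonneg_left (h1.trans ?_) (by positivity)
        rw [mul_pow]
        exact mul_le_mul_of_nonneg_right h2 (sq_nonneg _)
    _ = _ := by ring

theorem mem_op_graph {v w : W} : (v, w) ∈ S.op.graph ↔
    (Summable fun k => ‖S.block k v‖ ^ 2) ∧ HasSum (fun k => S.block k v) w := by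
  rw [op_graph]
  rfl

theorem proj_of_mem_op_graph [CompleteSpace W] {v w : W} (h : (v, w) ∈ S.op.graph) (k : ι) :
    S.proj k w = S.block k v := by
  obtain ⟨h1, h2⟩ := S.mem_op_graph.1 h
  obtain ⟨w', h3, h4⟩ := S.hasSum_of_mem_blockSpace (fun k => S.block_mem_blockSpace k v) h1
  rw [h2.unique h3, h4]

theorem scaleNorm_le_of_mem_op_graph [CompleteSpace W] {N : ℕ} (hN : ∀ k, S.n k ≤ N) {α : ℝ}
    {v w : W} (hv : v ∈ S.scale (α + 1)) (h : (v, w) ∈ S.op.graph) :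
    w ∈ S.scale α ∧ S.scaleNorm α w ≤ (1 + N) * S.scaleNorm (α + 1) v :=
  S.mem_scale_and_scaleNorm_le (by positivity) hv fun k => by
    rw [S.proj_of_mem_op_graph h]
    exact S.weight_mul_norm_block_sq_le hN α k v

theorem exists_mem_op_graph [CompleteSpace W] {α : ℝ} (hα : 0 ≤ α) {v : W}
    (hv : v ∈ S.scale (α + 1)) : ∃ w ∈ S.scale α, (v, w) ∈ S.op.graph := by
  obtain ⟨N, hN⟩ := S.n_bdd
  have hs : Summable fun k => ‖S.block k v‖ ^ 2 := by
    refine Summable.of_nonneg_of_le (fun k => sq_nonneg _) (fun k => ?_)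
      (Summable.mul_left ((1 + N : ℝ) ^ 2) (S.mem_scale.1 (S.scale_mono (α := 0 + 1)
        (by linarith) hv).1))
    simpa using S.weight_mul_norm_block_sq_le hN 0 k v
  obtain ⟨w, h1, -⟩ := S.hasSum_of_mem_blockSpace (fun k => S.block_mem_blockSpace k v) hs
  have h2 : (v, w) ∈ S.op.graph := S.mem_op_graph.2 ⟨hs, h1⟩
  exact ⟨w, (S.scaleNorm_le_of_mem_op_graph hN hv h2).1, h2⟩

theorem block_basis (k : ι) (l : Fin (S.n k)) :
    S.block k (S.φ ⟨k, l⟩) = S.freq k • S.φ ⟨k, l⟩ + S.pred k l := by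
  rw [block_apply, Finset.sum_eq_single l]
  · rw [coeff_basis_self, one_smul]
  · intro l' _ h
    rw [S.coeff_basis_of_ne h, zero_smul]
  · simp

theorem basis_mem_op_graph (k : ι) (l : Fin (S.n k)) :
    (S.φ ⟨k, l⟩, S.freq k • S.φ ⟨k, l⟩ + S.pred k l) ∈ S.op.graph := by
  have h : ∀ k' ≠ k, S.block k' (S.φ ⟨k, l⟩) = 0 := fun k' hk => by
    simp [block_apply, S.coeff_eq_zero_of_mem hk _ (S.basis_mem_blockSpace k l)]
  refine S.mem_op_graph.2 ⟨?_, ?_⟩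
  · refine summable_of_ne_finset_zero (s := {k}) fun k' hk' => ?_
    simp [h k' (by simpa using hk')]
  · rw [← block_basis]
    exact hasSum_single k h

theorem chain_mem_op_graph (k : ι) {j : ℕ} (hj : j < S.n k) :
    (S.chain k j, S.freq k • S.chain k j + if j = 0 then 0 else S.chain k (j - 1)) ∈
      S.op.graph := by
  have h := S.basis_mem_op_graph k ⟨j, hj⟩
  rw [← chain_coe] at h
  have h2 : S.pred k ⟨j, hj⟩ = if j = 0 then 0 else S.chain k (j - 1) := by
    rw [pred]
    split_ifs
    · rfl
    · rw [chain, dif_pos]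
  rwa [h2] at h

/-! #### The flow -/

/-- The exponential factor is unimodular, each coefficient `|t|^m / m!` is at most `exp |t|`, and
there are at most `N * N` terms. -/
theorem norm_flowBlock_le {N : ℕ} (hN : ∀ k, S.n k ≤ N) (k : ι) (t : ℝ) (v : W) :
    ‖S.flowBlock k t v‖ ≤ N * (N * Real.exp |t|) * ‖S.proj k v‖ := by
  have h1 : ‖Complex.exp (S.freq k * t)‖ = 1 := by
    simp [Complex.norm_exp, freq]
  rw [flowBlock_apply, norm_smul, h1, one_mul]
  refine (norm_sum_le _ _).trans ?_
  have h2 : ∀ l ∈ (Finset.univ : Finset (Fin (S.n k))), ‖S.coeff k l v •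
      ∑ j ∈ Finset.univ.filter (fun j => j ≤ l),
        ((t : ℂ) ^ ((l : ℕ) - (j : ℕ)) / (Nat.factorial ((l : ℕ) - (j : ℕ)) : ℂ)) •
          S.φ ⟨k, j⟩‖ ≤ (N * Real.exp |t|) * ‖S.proj k v‖ := by
    intro l _
    rw [norm_smul, mul_comm]
    refine mul_le_mul ?_ (S.norm_coeff_le k l v) (norm_nonneg _) (by positivity)
    refine (norm_sum_le _ _).trans ?_
    have h3 : ∀ j ∈ Finset.univ.filter (fun j => j ≤ l),
        ‖((t : ℂ) ^ ((l : ℕ) - (j : ℕ)) / (Nat.factorial ((l : ℕ) - (j : ℕ)) : ℂ)) •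
          S.φ ⟨k, j⟩‖ ≤ Real.exp |t| := by
      intro j _
      rw [norm_smul, S.φ.orthonormal.1, mul_one]
      simpa using Real.pow_div_factorial_le_exp _ (abs_nonneg t) ((l : ℕ) - (j : ℕ))
    refine (Finset.sum_le_card_nsmul _ _ _ h3).trans ?_
    rw [nsmul_eq_mul]
    refine mul_le_mul_of_nonneg_right ?_ (Real.exp_pos _).le
    have h4 : (Finset.univ.filter (fun j => j ≤ l)).card ≤ N :=
      ((Finset.card_filter_le _ _).trans (by simp)).trans (hN k)
    exact_mod_cast h4
  refine (Finset.sum_le_card_nsmul _ _ _ h2).trans ?_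
  rw [Finset.card_univ, Fintype.card_fin, nsmul_eq_mul, mul_assoc (N : ℝ) (_ * _)]
  exact mul_le_mul_of_nonneg_right (by exact_mod_cast hN k) (by positivity)

variable [CompleteSpace W]

theorem hasSum_flow_and_proj_flow (t : ℝ) (v : W) :
    HasSum (fun k => S.flowBlock k t v) (S.flow t v) ∧
      ∀ k, S.proj k (S.flow t v) = S.flowBlock k t v := by
  obtain ⟨N, hN⟩ := S.n_bdd
  have hs : Summable fun k => ‖S.flowBlock k t v‖ ^ 2 := by
    refine Summable.of_nonneg_of_le (fun k => sq_nonneg _) (fun k => ?_)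
      ((S.hasSum_norm_proj_sq v).summable.mul_left ((N * (N * Real.exp |t|)) ^ 2))
    rw [← mul_pow]
    exact pow_le_pow_left₀ (norm_nonneg _) (S.norm_flowBlock_le hN k t v) 2
  obtain ⟨w, h1, h2⟩ := S.hasSum_of_mem_blockSpace
    (fun k => S.flowBlock_mem_blockSpace k t v) hs
  have h3 : S.flow t v = w := by rw [flow_eq, h1.tsum_eq]
  rw [h3]
  exact ⟨h1, h2⟩

/-- The flow as a linear map. -/
def flowLin (t : ℝ) : W →ₗ[ℂ] W where
  toFun := S.flow t
  map_add' v w := by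
    refine (S.hasSum_flow_and_proj_flow t (v + w)).1.unique ?_
    simpa using (S.hasSum_flow_and_proj_flow t v).1.add (S.hasSum_flow_and_proj_flow t w).1
  map_smul' c v := by
    refine (S.hasSum_flow_and_proj_flow t (c • v)).1.unique ?_
    simpa using (S.hasSum_flow_and_proj_flow t v).1.const_smul c

theorem flowLin_apply (t : ℝ) (v : W) : S.flowLin t v = S.flow t v := rfl

theorem flow_mem_scale {N : ℕ} (hN : ∀ k, S.n k ≤ N) (t : ℝ) {α : ℝ} {v : W}
    (hv : v ∈ S.scale α) : S.flow t v ∈ S.scale α ∧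
      S.scaleNorm α (S.flow t v) ≤ N * (N * Real.exp |t|) * S.scaleNorm α v :=
  S.mem_scale_and_scaleNorm_le (by positivity) hv fun k => by
    rw [(S.hasSum_flow_and_proj_flow t v).2]
    have h := pow_le_pow_left₀ (norm_nonneg _) (S.norm_flowBlock_le hN k t v) 2
    rw [mul_pow] at h
    refine (mul_le_mul_of_nonneg_left h (Real.rpow_nonneg (by positivity) α)).trans_eq ?_
    ring

theorem norm_flow_le {N : ℕ} (hN : ∀ k, S.n k ≤ N) (t : ℝ) (v : W) :
    ‖S.flow t v‖ ≤ N * (N * Real.exp |t|) * ‖v‖ := by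
  simpa [scaleNorm_zero] using (S.flow_mem_scale hN t (S.mem_scale_zero v)).2

theorem flow_of_mem_blockSpace {k : ι} {x : W} (hx : x ∈ S.blockSpace k) (t : ℝ) :
    S.flow t x = S.flowBlock k t x := by
  refine (S.hasSum_flow_and_proj_flow t x).1.unique (hasSum_single k fun k' hk => ?_)
  simp [flowBlock_apply, S.coeff_eq_zero_of_mem hk _ hx]

/-- Flows of finite truncations are continuous and approximate the flow uniformly on the unit ball
around `t`, where `|r| ≤ |t| + 1`. -/
theorem continuous_flow (v : W) : Continuous fun t => S.flow t v := by
  obtain ⟨N, hN⟩ := S.n_bdd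
  refine continuous_iff_continuousAt.2 fun t =>
    continuousAt_of_locally_uniform_approx_of_continuousAt fun u hu => ?_
  obtain ⟨ε, hε, hu⟩ := Metric.mem_uniformity_dist.1 hu
  set C : ℝ := N * (N * Real.exp (|t| + 1)) with hC
  have hlim : Tendsto (fun s : Finset ι => C * ‖v - ∑ k ∈ s, S.proj k v‖) atTop (𝓝 0) := by
    have h := (tendsto_const_nhds (x := v)).sub (S.hasSum_proj v)
    simpa using h.norm.const_mul C
  obtain ⟨s, hs⟩ := (hlim.eventually_lt_const hε).exists
  refine ⟨Metric.ball t 1, Metric.ball_mem_nhds t one_pos,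
    fun r => ∑ k ∈ s, S.flowBlock k r (S.proj k v), ?_, fun r hr => hu ?_⟩
  · refine Continuous.continuousAt (continuous_finsetSum _ fun k _ => ?_)
    simp only [flowBlock_apply]
    fun_prop
  · have h1 : ∑ k ∈ s, S.flowBlock k r (S.proj k v) = S.flow r (∑ k ∈ s, S.proj k v) := by
      rw [← flowLin_apply, map_sum]
      exact Finset.sum_congr rfl fun k _ =>
        (S.flow_of_mem_blockSpace (S.proj_mem_blockSpace k v) r).symm
    simp only [h1]
    rw [dist_eq_norm, ← flowLin_apply, ← flowLin_apply, ← map_sub]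
    refine ((S.norm_flow_le hN r _).trans (mul_le_mul_of_nonneg_right ?_ (norm_nonneg _))).trans_lt hs
    rw [hC]
    have h2 : |r| ≤ |t| + 1 := by
      have h3 : |r - t| < 1 := hr
      have := abs_sub_abs_le_abs_sub r t
      linarith
    have := Real.exp_le_exp.2 h2
    gcongr

/-- The flow as a linear map on `W_α`. -/
def flowScale (α t : ℝ) : S.scale α →ₗ[ℂ] S.scale α :=
  (S.flowLin t).restrict fun _ hv => (S.flow_mem_scale S.n_bdd.choose_spec t hv).1

theorem coe_flowScale (α t : ℝ) (v : S.scale α) : (S.flowScale α t v : W) = S.flow t v := rfl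

theorem flow_basis (k : ι) (l : Fin (S.n k)) (t : ℝ) : S.flow t (S.φ ⟨k, l⟩) =
    ∑ m ∈ Finset.range (l + 1), chainCoeff (S.freq k) m t • S.chain k (l - m) := by
  rw [S.flow_of_mem_blockSpace (S.basis_mem_blockSpace k l), flowBlock_apply,
    Finset.sum_eq_single l, coeff_basis_self, one_smul]
  · simp only [chainCoeff, mul_smul, ← Finset.smul_sum]
    congr 1
    refine Finset.sum_bij' (fun j _ => (l : ℕ) - j)
      (fun m _ => ⟨(l : ℕ) - m, lt_of_le_of_lt (Nat.sub_le _ _) l.2⟩) ?_ ?_ ?_ ?_ ?_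
    · intro j _
      simp only [Finset.mem_range]
      omega
    · intro m _
      rw [Finset.mem_filter, Fin.le_def]
      exact ⟨Finset.mem_univ _, Nat.sub_le _ _⟩
    · intro j hj
      have : (j : ℕ) ≤ l := (Finset.mem_filter.1 hj).2
      apply Fin.ext
      simp only
      omega
    · intro m hm
      simp only [Finset.mem_range] at hm
      simp only
      omega
    · intro j hj
      have : (j : ℕ) ≤ l := (Finset.mem_filter.1 hj).2
      have h2 : (l : ℕ) - (l - j) = j := by omega
      simp only [h2, chain, j.2, dif_pos]
  · intro l' _ h
    rw [S.coeff_basis_of_ne h, zero_smul]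
  · simp

theorem flow_chain (k : ι) {j : ℕ} (hj : j < S.n k) (t : ℝ) : S.flow t (S.chain k j) =
    ∑ m ∈ Finset.range (j + 1), chainCoeff (S.freq k) m t • S.chain k (j - m) := by
  rw [← S.flow_basis k ⟨j, hj⟩, ← chain_coe]

theorem flowScale_chain (α : ℝ) (k : ι) {j : ℕ} (hj : j < S.n k) (t : ℝ) :
    S.flowScale α t (S.scaleChain α k j) =
      ∑ m ∈ Finset.range (j + 1), chainCoeff (S.freq k) m t • S.scaleChain α k (j - m) := by
  apply Subtype.ext
  rw [coe_flowScale]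
  simpa [scaleChain] using S.flow_chain k hj t

end Exosystem

/-! ### Sylvester equations -/

section Sylvester

variable {ι W E Y : Type*} [NormedAddCommGroup W] [InnerProductSpace ℂ W]
  [NormedAddCommGroup E] [NormedSpace ℂ E] [NormedAddCommGroup Y] [NormedSpace ℂ Y]

/-- `Sig ∈ L(W_α, E)` solves the Sylvester equation `Sig S = A Sig + B` on `W_(α+1)`. -/
structure IsSylvesterSolution (S : Exosystem ι W) (α : ℝ) (A : E →ₗ.[ℂ] E) (B : W →L[ℂ] E)
    (Sig : S.scale α →ₗ[ℂ] E) : Prop where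
  bound : ∃ c : ℝ, ∀ v, ‖Sig v‖ ≤ c * S.scaleNorm α v
  eq : ∀ v : S.scale α, (v : W) ∈ S.scale (α + 1) →
    ∃ (Sv : S.scale α) (a : E), ((v : W), (Sv : W)) ∈ S.op.graph ∧
      (Sig v, a) ∈ A.graph ∧ Sig Sv = a + B v

/-- A combination of a Jordan chain with the coefficients of the exponential of a Jordan block
is a mild solution. -/
theorem Generates.mildState_chain [CompleteSpace E] {A : E →ₗ.[ℂ] E} {T : ℝ → E →L[ℂ] E}
    (hA : Generates A T) (μ : ℂ) {x a b : ℕ → E} {l : ℕ} (hxa : ∀ j ≤ l, (x j, a j) ∈ A.graph)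
    (hx : ∀ j ≤ l, μ • x j + (if j = 0 then 0 else x (j - 1)) = a j + b j) {t : ℝ} (ht : 0 ≤ t) :
    mildState T (x l) (fun s => ∑ m ∈ Finset.range (l + 1), chainCoeff μ m s • b (l - m)) t =
      ∑ m ∈ Finset.range (l + 1), chainCoeff μ m t • x (l - m) := by
  have h0 : ∑ m ∈ Finset.range (l + 1), chainCoeff μ m 0 • x (l - m) = x l := by
    simp [chainCoeff_at_zero]
  have key := hA.mildState_eq
    (h := fun s => ∑ m ∈ Finset.range (l + 1), chainCoeff μ m s • x (l - m))
    (g := fun s => ∑ m ∈ Finset.range (l + 1), chainCoeff μ m s • b (l - m))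
    (continuous_finsetSum _ fun m _ => (continuous_chainCoeff μ m).smul continuous_const)
    (fun s => ⟨∑ m ∈ Finset.range (l + 1), chainCoeff μ m s • a (l - m), ?_, ?_⟩) ht
  · simpa only [h0] using key
  · have h1 := A.graph.sum_mem (t := Finset.range (l + 1)) fun m _ =>
      A.graph.smul_mem (chainCoeff μ m s) (hxa (l - m) (Nat.sub_le _ _))
    convert h1 using 1
    simp [Prod.ext_iff, Prod.fst_sum, Prod.snd_sum]
  · refine (HasDerivAt.fun_sum fun m _ =>
      (hasDerivAt_chainCoeff μ m s).smul_const (x (l - m))).congr_deriv ?_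
    rw [← Finset.sum_add_distrib]
    simp only [← smul_add, ← hx _ (Nat.sub_le _ _)]
    simp only [smul_add, add_smul, Finset.sum_add_distrib]
    congr 1
    · refine Finset.sum_congr rfl fun m _ => ?_
      rw [smul_smul, mul_comm]
    -- The two sums agree after an index shift: the term `m = 0` on the left and the term `m = l` on
    -- the right both vanish.
    · rw [Finset.sum_range_succ', Finset.sum_range_succ]
      simp only [Nat.add_sub_cancel, Nat.succ_ne_zero, if_false, if_true, zero_smul, add_zero,
        Nat.sub_self, smul_zero]
      refine Finset.sum_congr rfl fun m hm => ?_
      rw [if_neg (Nat.sub_ne_zero_of_lt (Finset.mem_range.1 hm)), Nat.sub_sub]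

namespace IsSylvesterSolution

variable {S : Exosystem ι W} {α : ℝ} {A : E →ₗ.[ℂ] E} {B : W →L[ℂ] E}
  {Sig : S.scale α →ₗ[ℂ] E}

theorem exists_bound_nonneg (h : IsSylvesterSolution S α A B Sig) :
    ∃ c : ℝ, 0 ≤ c ∧ ∀ v, ‖Sig v‖ ≤ c * S.scaleNorm α v := by
  obtain ⟨c, hc⟩ := h.bound
  exact ⟨max c 0, le_max_right _ _, fun v => (hc v).trans
    (mul_le_mul_of_nonneg_right (le_max_left _ _) (S.scaleNorm_nonneg _ _))⟩

theorem mem_domain (h : IsSylvesterSolution S α A B Sig) {v : S.scale α}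
    (hv : (v : W) ∈ S.scale (α + 1)) : Sig v ∈ A.domain := by
  obtain ⟨-, a, -, h2, -⟩ := h.eq v hv
  exact LinearPMap.mem_domain_of_mem_graph h2

theorem scaleChain_mem_scale (S : Exosystem ι W) (α β : ℝ) (k : ι) (j : ℕ) :
    (S.scaleChain α k j : W) ∈ S.scale β :=
  S.mem_scale_of_mem_blockSpace β (S.chain_mem_blockSpace k j)

theorem exists_chain (h : IsSylvesterSolution S α A B Sig) (k : ι) {j : ℕ} (hj : j < S.n k) :
    ∃ a, (Sig (S.scaleChain α k j), a) ∈ A.graph ∧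
      S.freq k • Sig (S.scaleChain α k j) +
        (if j = 0 then 0 else Sig (S.scaleChain α k (j - 1))) = a + B (S.chain k j) := by
  obtain ⟨Sv, a, h1, h2, h3⟩ := h.eq _ (scaleChain_mem_scale S α (α + 1) k j)
  refine ⟨a, h2, ?_⟩
  have h4 : Sv = S.freq k • S.scaleChain α k j +
      (if j = 0 then 0 else S.scaleChain α k (j - 1)) := by
    apply Subtype.ext
    rw [LinearPMap.mem_graph_snd_inj _ h1 (S.chain_mem_op_graph k hj) rfl]
    split_ifs <;> rfl
  have h5 : Sig Sv = a + B (S.chain k j) := h3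
  rw [← h5, h4, map_add, map_smul, apply_ite Sig, map_zero]

variable [CompleteSpace W]

theorem mildState_scaleChain [CompleteSpace E] (h : IsSylvesterSolution S α A B Sig)
    {T : ℝ → E →L[ℂ] E} (hA : Generates A T) (k : ι) {j : ℕ} (hj : j < S.n k) {t : ℝ}
    (ht : 0 ≤ t) :
    mildState T (Sig (S.scaleChain α k j)) (fun s => B (S.flow s (S.chain k j))) t =
      Sig (S.flowScale α t (S.scaleChain α k j)) := by
  have h1 : ∀ i, ∃ a, i ≤ j → (Sig (S.scaleChain α k i), a) ∈ A.graph ∧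
      S.freq k • Sig (S.scaleChain α k i) +
        (if i = 0 then 0 else Sig (S.scaleChain α k (i - 1))) = a + B (S.chain k i) := by
    intro i
    by_cases hi : i ≤ j
    · obtain ⟨a, ha⟩ := h.exists_chain k (hi.trans_lt hj)
      exact ⟨a, fun _ => ha⟩
    · exact ⟨0, fun h => absurd h hi⟩
  choose a ha using h1
  have key := hA.mildState_chain (S.freq k) (fun i hi => (ha i hi).1) (fun i hi => (ha i hi).2) ht
  simp only [S.flow_chain k hj, S.flowScale_chain α k hj, map_sum, map_smul]
  exact key

/-- For fixed `t` both sides are linear in `v` and bounded in the norm of `W_α`, and they agree on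
Jordan chains. Density replaces a differentiation of `Sig T_S(t) v` for general `v`. -/
theorem mildState_eq [CompleteSpace E] (hα : 0 ≤ α) (h : IsSylvesterSolution S α A B Sig)
    {T : ℝ → E →L[ℂ] E} (hA : Generates A T) (v : S.scale α) {t : ℝ} (ht : 0 ≤ t) :
    mildState T (Sig v) (fun s => B (S.flow s v)) t = Sig (S.flowScale α t v) := by
  have hint : ∀ v : W, IntervalIntegrable (fun s => T (t - s) (B (S.flow s v)))
      MeasureTheory.volume 0 t := fun v => (hA.1.continuousOn_apply_sub
    (B.continuous.comp (S.continuous_flow v)).continuousOn).intervalIntegrable_of_Icc ht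
  let M : S.scale α →ₗ[ℂ] E :=
    { toFun := fun v => mildState T (Sig v) (fun s => B (S.flow s v)) t - Sig (S.flowScale α t v)
      map_add' := fun v w => by
        have h1 : (fun s => T (t - s) (B (S.flow s (v + w : S.scale α)))) =
            fun s => T (t - s) (B (S.flow s v)) + T (t - s) (B (S.flow s w)) := by
          funext s
          rw [← map_add, ← map_add]
          exact congrArg (fun x => T (t - s) (B x)) ((S.flowLin s).map_add v w)
        simp only [mildState, h1, intervalIntegral.integral_add (hint v) (hint w), map_add]
        abel
      map_smul' := fun c v => by
        have h1 : (fun s => T (t - s) (B (S.flow s (c • v : S.scale α)))) =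
            fun s => c • T (t - s) (B (S.flow s v)) := by
          funext s
          rw [← map_smul, ← map_smul]
          exact congrArg (fun x => T (t - s) (B x)) ((S.flowLin s).map_smul c v)
        simp only [mildState, h1, intervalIntegral.integral_smul, map_smul, RingHom.id_apply,
          smul_sub, smul_add] }
  obtain ⟨c, hc0, hc⟩ := h.exists_bound_nonneg
  obtain ⟨N, hN⟩ := S.n_bdd
  obtain ⟨C, hC0, hC⟩ := hA.1.exists_bound t
  set D : ℝ := N * (N * Real.exp |t|) with hD
  have hD0 : 0 ≤ D := by positivity
  have hM : ∀ v, ‖M v‖ ≤ (C * c + C * (‖B‖ * D) * t + c * D) * S.scaleNorm α v := by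
    intro v
    have hv := S.norm_le_scaleNorm hα v.2
    have h1 : ‖T t (Sig v)‖ ≤ C * c * S.scaleNorm α v := by
      rw [mul_assoc]
      exact ((T t).le_opNorm _).trans (mul_le_mul (hC t ht le_rfl) (hc v) (norm_nonneg _) hC0)
    have h2 : ‖Sig (S.flowScale α t v)‖ ≤ c * D * S.scaleNorm α v := by
      rw [mul_assoc]
      exact (hc _).trans (mul_le_mul_of_nonneg_left (S.flow_mem_scale hN t v.2).2 hc0)
    have h3 : ‖∫ s in (0 : ℝ)..t, T (t - s) (B (S.flow s v))‖ ≤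
        C * (‖B‖ * (D * S.scaleNorm α v)) * |t - 0| := by
      refine intervalIntegral.norm_integral_le_of_norm_le_const fun s hs => ?_
      rw [Set.uIoc_of_le ht] at hs
      refine ((T (t - s)).le_opNorm _).trans (mul_le_mul (hC _ (by linarith [hs.2])
        (by linarith [hs.1])) ?_ (norm_nonneg _) hC0)
      refine (B.le_opNorm _).trans (mul_le_mul_of_nonneg_left ?_ (norm_nonneg _))
      refine (S.norm_flow_le hN s v).trans (mul_le_mul ?_ hv (norm_nonneg _) hD0)
      have h4 : |s| ≤ |t| := by
        rw [abs_of_pos hs.1, abs_of_nonneg ht]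
        exact hs.2
      have := Real.exp_le_exp.2 h4
      rw [hD]
      gcongr
    rw [sub_zero, abs_of_nonneg ht] at h3
    change ‖(T t (Sig v) + ∫ s in (0 : ℝ)..t, T (t - s) (B (S.flow s v))) -
      Sig (S.flowScale α t v)‖ ≤ _
    refine (norm_sub_le _ _).trans ((add_le_add ((norm_add_le _ _).trans (add_le_add h1 h3))
      h2).trans_eq ?_)
    ring
  exact sub_eq_zero.1 (S.eq_zero_of_chain M hM
    (fun k j hj => sub_eq_zero.2 (h.mildState_scaleChain hA k hj ht)) v)

/-- If `C Sig + F` vanishes on the Jordan chains, then it vanishes on `W_(α+1)`. -/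
theorem output_eq_zero (hα : 0 ≤ α) (h : IsSylvesterSolution S α A B Sig) {C : E →ₗ.[ℂ] Y}
    (hC : RelBounded A C) {F : W →L[ℂ] Y}
    (hF : ∀ k, ∀ j < S.n k, ∀ y, (Sig (S.scaleChain α k j), y) ∈ C.graph →
      y + F (S.chain k j) = 0)
    {v : S.scale α} (hv : (v : W) ∈ S.scale (α + 1)) {y : Y} (hy : (Sig v, y) ∈ C.graph) :
    y + F v = 0 := by
  obtain ⟨hdom, a, b, hab⟩ := hC
  obtain ⟨c, hc0, hc⟩ := h.exists_bound_nonneg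
  obtain ⟨N, hN⟩ := S.n_bdd
  have hle : S.scale (α + 1) ≤ S.scale α := fun v hv => (S.scale_mono (by linarith) hv).1
  let j : S.scale (α + 1) →ₗ[ℂ] S.scale α := Submodule.inclusion hle
  have hj : ∀ v, (Sig.comp j) v ∈ C.domain := fun v => hdom (h.mem_domain v.2)
  let M : S.scale (α + 1) →ₗ[ℂ] Y :=
    C.toFun.comp ((Sig.comp j).codRestrict C.domain hj) +
      F.toLinearMap.comp (S.scale (α + 1)).subtype
  have hgraph : ∀ v, (Sig (j v), M v - F v) ∈ C.graph := by
    intro v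
    have h1 : M v - F v = C ⟨Sig (j v), hj v⟩ := add_sub_cancel_right _ _
    rw [h1]
    exact LinearPMap.mem_graph C ⟨Sig (j v), hj v⟩
  -- Relative boundedness controls `C Sig v` by `Sig v` and `A Sig v`; the latter equals `Sig S v -
  -- B v`, and `S` is bounded from `W_(α+1)` to `W_α`.
  have hM : ∀ v, ‖M v‖ ≤ (|a| * c + |b| * (c * (1 + N) + ‖B‖) + ‖F‖) * S.scaleNorm (α + 1) v := by
    intro v
    obtain ⟨Sv, a', h1, h2, h3⟩ := h.eq (j v) v.2
    have h4 := hab _ _ _ h2 (hgraph v)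
    have hvn := S.norm_le_scaleNorm (by linarith : 0 ≤ α + 1) v.2
    have hvα := (S.scale_mono (by linarith : α ≤ α + 1) v.2).2
    have hFv : ‖F v‖ ≤ ‖F‖ * S.scaleNorm (α + 1) v :=
      (F.le_opNorm _).trans (mul_le_mul_of_nonneg_left hvn (norm_nonneg _))
    have hBv : ‖B v‖ ≤ ‖B‖ * S.scaleNorm (α + 1) v :=
      (B.le_opNorm _).trans (mul_le_mul_of_nonneg_left hvn (norm_nonneg _))
    have hSig : ‖Sig (j v)‖ ≤ c * S.scaleNorm (α + 1) v :=
      (hc _).trans (mul_le_mul_of_nonneg_left hvα hc0)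
    have hSv : ‖Sig Sv‖ ≤ c * ((1 + N) * S.scaleNorm (α + 1) v) :=
      (hc _).trans (mul_le_mul_of_nonneg_left (S.scaleNorm_le_of_mem_op_graph hN v.2 h1).2 hc0)
    have ha' : ‖a'‖ ≤ (c * (1 + N) + ‖B‖) * S.scaleNorm (α + 1) v := by
      have : a' = Sig Sv - B v := eq_sub_of_add_eq h3.symm
      rw [this]
      refine (norm_sub_le _ _).trans ((add_le_add hSv hBv).trans_eq ?_)
      ring
    have h5 : ‖M v‖ ≤ ‖M v - F v‖ + ‖F v‖ := by
      simpa using norm_add_le (M v - F v) (F v)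
    have h6 : a * ‖Sig (j v)‖ ≤ |a| * (c * S.scaleNorm (α + 1) v) :=
      mul_le_mul (le_abs_self a) hSig (norm_nonneg _) (abs_nonneg _)
    have h7 : b * ‖a'‖ ≤ |b| * ((c * (1 + N) + ‖B‖) * S.scaleNorm (α + 1) v) :=
      mul_le_mul (le_abs_self b) ha' (norm_nonneg _) (abs_nonneg _)
    refine (h5.trans (add_le_add (h4.trans (add_le_add h6 h7)) hFv)).trans_eq ?_
    ring
  have h0 := S.eq_zero_of_chain M hM (fun k i hi => by
    have := hF k i hi _ (hgraph (S.scaleChain (α + 1) k i))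
    simpa [Exosystem.scaleChain] using this) ⟨v, hv⟩
  have h1 := hgraph ⟨v, hv⟩
  rw [h0] at h1
  rw [LinearPMap.mem_graph_snd_inj _ hy h1 rfl]
  simp

/-- If the error of the steady state decays, then `C Sig + F` vanishes on the Jordan chains. -/
theorem output_chain_eq_zero [CompleteSpace E] (h : IsSylvesterSolution S α A B Sig)
    {T : ℝ → E →L[ℂ] E} (hA : Generates A T) {C : E →ₗ.[ℂ] Y} (hC : A.domain ≤ C.domain)
    {F : W →L[ℂ] Y}
    (hdecay : ∀ x₀ ∈ A.domain, ∀ v₀ ∈ S.scale (α + 1), ∃ e : ℝ → Y,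
      (∀ t, 0 ≤ t → ∃ y, (mildState T x₀ (fun s => B (S.flow s v₀)) t, y) ∈ C.graph ∧
        e t = y + F (S.flow t v₀)) ∧ Tendsto e atTop (𝓝 0))
    (k : ι) (j : ℕ) (hj : j < S.n k) (y : Y) (hy : (Sig (S.scaleChain α k j), y) ∈ C.graph) :
    y + F (S.chain k j) = 0 := by
  have hex : ∀ i, ∃ c, (Sig (S.scaleChain α k i), c) ∈ C.graph := fun i =>
    LinearPMap.mem_domain_iff.1 (hC (h.mem_domain (scaleChain_mem_scale S α (α + 1) k i)))
  choose c hc using hex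
  suffices hz : ∀ j, j < S.n k → c j + F (S.chain k j) = 0 by
    rw [LinearPMap.mem_graph_snd_inj _ hy (hc j) rfl]
    exact hz j hj
  clear hy hj y j
  intro j
  induction j using Nat.strong_induction_on with
  | _ j ih =>
    intro hj
    obtain ⟨e, he, hlim⟩ := hdecay _ (h.mem_domain (scaleChain_mem_scale S α (α + 1) k j)) _
      (scaleChain_mem_scale S α (α + 1) k j)
    -- Starting at `Sig φ_k^j` leaves no transient. The lower chain members contribute nothing by
    -- induction, and the remaining coefficient `exp(i ω_k t)` has modulus one.
    have h1 : ∀ t, 0 ≤ t → ‖e t‖ = ‖c j + F (S.chain k j)‖ := by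
      intro t ht
      obtain ⟨y, hy, hey⟩ := he t ht
      have h2 : (Sig (S.flowScale α t (S.scaleChain α k j)), y) ∈ C.graph := by
        rw [← h.mildState_scaleChain hA k hj ht]
        exact hy
      rw [S.flowScale_chain α k hj, map_sum] at h2
      simp only [map_smul] at h2
      have h3 := C.graph.sum_mem (t := Finset.range (j + 1)) fun m _ =>
        C.graph.smul_mem (chainCoeff (S.freq k) m t) (hc (j - m))
      have h4 : y = ∑ m ∈ Finset.range (j + 1), chainCoeff (S.freq k) m t • c (j - m) := by
        refine (LinearPMap.mem_graph_snd_inj' _ h2 h3 ?_).trans ?_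
        · simp [Prod.fst_sum]
        · simp [Prod.snd_sum]
      have h5 : e t = ∑ m ∈ Finset.range (j + 1), chainCoeff (S.freq k) m t •
          (c (j - m) + F (S.chain k (j - m))) := by
        have h6 : F (S.flow t (S.scaleChain α k j : W)) = _ :=
          congrArg F (S.flow_chain k hj t)
        rw [hey, h4, h6, map_sum, ← Finset.sum_add_distrib]
        simp only [map_smul, smul_add]
      rw [h5, Finset.sum_eq_single 0]
      · rw [norm_smul]
        simp [chainCoeff, Complex.norm_exp, Exosystem.freq]
      · intro m hm hm0
        rw [Finset.mem_range] at hm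
        rw [ih (j - m) (by omega) (by omega), smul_zero]
      · simp
    have h2 : Tendsto (fun t => ‖e t‖) atTop (𝓝 ‖c j + F (S.chain k j)‖) := by
      refine tendsto_const_nhds.congr' ?_
      filter_upwards [eventually_ge_atTop 0] with t ht using (h1 t ht).symm
    simpa using tendsto_nhds_unique h2 hlim.norm

end IsSylvesterSolution

end Sylvester

/-! ### Robust output regulation -/

section Kernels

variable {Z : Type*} [NormedAddCommGroup Z] [NormedSpace ℂ Z] {A : Z →ₗ.[ℂ] Z} {μ : ℂ}

theorem neg_mem_kerPow {m : ℕ} {x : Z} (hx : x ∈ kerPow A μ m) : -x ∈ kerPow A μ m := by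
  induction m generalizing x with
  | zero =>
    rw [Set.mem_singleton_iff.1 hx, neg_zero]
    rfl
  | succ m ih =>
    obtain ⟨y, h1, h2⟩ := hx
    exact ⟨-y, (shift A μ).graph.neg_mem h1, ih h2⟩

theorem zero_mem_kerPow (m : ℕ) : (0 : Z) ∈ kerPow A μ m := by
  induction m with
  | zero => rfl
  | succ m ih => exact ⟨0, (shift A μ).graph.zero_mem, ih⟩

theorem kerPow_mono {m m' : ℕ} (h : m ≤ m') : kerPow A μ m ⊆ kerPow A μ m' := by
  induction m generalizing m' with
  | zero =>
    intro x hx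
    rw [Set.mem_singleton_iff.1 hx]
    exact zero_mem_kerPow m'
  | succ m ih =>
    obtain ⟨m', rfl⟩ : ∃ i, m' = i + 1 := ⟨m' - 1, by omega⟩
    rintro x ⟨y, h1, h2⟩
    exact ⟨y, h1, ih (by omega) h2⟩

/-- Every element of `ker (μ - A)^m` ends a chain of length `m`. -/
theorem exists_chain_of_mem_kerPow {m : ℕ} {x : Z} (hx : x ∈ kerPow A μ m) :
    ∃ z w : ℕ → Z, (∀ j, (z j, w j) ∈ A.graph) ∧
      (∀ j < m, μ • z j - w j + (if j = 0 then 0 else z (j - 1)) = 0) ∧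
      (if m = 0 then 0 else z (m - 1)) = x := by
  induction m generalizing x with
  | zero =>
    exact ⟨0, 0, fun _ => A.graph.zero_mem, fun j hj => absurd hj (Nat.not_lt_zero j),
      (Set.mem_singleton_iff.1 hx).symm⟩
  | succ m ih =>
    obtain ⟨y, h1, h2⟩ := hx
    -- The chain relation reads `(μ - A) z_j = -z_{j-1}`, hence the sign; `x` is then appended at
    -- index `m`.
    obtain ⟨z, w, h3, h4, h5⟩ := ih (neg_mem_kerPow h2)
    refine ⟨Function.update z m x, Function.update w m (μ • x - y), fun j => ?_, fun j hj => ?_,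
      by simp⟩
    · rcases eq_or_ne j m with rfl | hj
      · simpa using mem_shift_graph.1 h1
      · simpa [hj] using h3 j
    · have h6 : (if j = 0 then 0 else Function.update z m x (j - 1)) =
          if j = 0 then 0 else z (j - 1) := by
        split_ifs with h0
        · rfl
        · rw [Function.update_of_ne (by omega)]
      rw [h6]
      rcases eq_or_ne j m with rfl | hjm
      · simp [h5]
      · simpa [hjm] using h4 j (by omega)

end Kernels

/-! ### Operators supported on a single Jordan chain. -/

section ChainMap

variable {ι W V : Type*} [NormedAddCommGroup W] [InnerProductSpace ℂ W] [NormedAddCommGroup V]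
  [NormedSpace ℂ V]

/-- The operator that maps the `k`-th Jordan chain to `x` and vanishes on the other ones. -/
def Exosystem.chainMap (S : Exosystem ι W) (k : ι) (x : ℕ → V) : W →L[ℂ] V :=
  ∑ l : Fin (S.n k), (innerSL ℂ (S.φ ⟨k, l⟩)).smulRight (x l)

variable (S : Exosystem ι W) (k : ι) (x : ℕ → V)

theorem Exosystem.chainMap_apply (v : W) :
    S.chainMap k x v = ∑ l : Fin (S.n k), S.coeff k l v • x l := by
  simp [chainMap, coeff_apply]

theorem Exosystem.chainMap_basis (l : Fin (S.n k)) : S.chainMap k x (S.φ ⟨k, l⟩) = x l := by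
  rw [chainMap_apply, Finset.sum_eq_single l]
  · rw [coeff_basis_self, one_smul]
  · intro l' _ h
    rw [S.coeff_basis_of_ne h, zero_smul]
  · simp

theorem Exosystem.chainMap_chain {j : ℕ} (hj : j < S.n k) :
    S.chainMap k x (S.chain k j) = x j := by
  simpa [← chain_coe] using S.chainMap_basis k x ⟨j, hj⟩

theorem Exosystem.chainMap_proj (v : W) : S.chainMap k x (S.proj k v) = S.chainMap k x v := by
  simp only [chainMap_apply, coeff_proj]

theorem Exosystem.chainMap_block (v : W) : S.chainMap k x (S.block k v) =
    ∑ l : Fin (S.n k), S.coeff k l v •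
      (S.freq k • x l + if (l : ℕ) = 0 then 0 else x (l - 1)) := by
  rw [block_apply, map_sum]
  refine Finset.sum_congr rfl fun l _ => ?_
  rw [map_smul, map_add, map_smul, chainMap_basis, pred]
  split_ifs
  · rw [map_zero]
  · rw [chainMap_basis]

end ChainMap

/-! ### Sufficiency and necessity of the `𝒢`-conditions. -/

section Regulation

variable {ι X U Y Z W : Type*} [NormedAddCommGroup X] [NormedSpace ℂ X] [CompleteSpace X]
  [NormedAddCommGroup U] [NormedSpace ℂ U] [NormedAddCommGroup Y] [NormedSpace ℂ Y]
  [NormedAddCommGroup Z] [NormedSpace ℂ Z]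
  [NormedAddCommGroup W] [InnerProductSpace ℂ W]
  {S : Exosystem ι W} {α : ℝ} {P : Plant X U Y} {G : Controller Y Z U}
  {E : W →L[ℂ] X} {F : W →L[ℂ] Y}

/-- Under the `𝒢`-conditions `C_e Sig + F` vanishes on the Jordan chains. -/
theorem GConditions.output_chain_eq_zero (hG : GConditions S G) {Sig : S.scale α →ₗ[ℂ] X × Z}
    (hSig : IsSylvesterSolution S α (Ae P G) (Be G E F) Sig) (k : ι) (j : ℕ) (hj : j < S.n k)
    (y : Y) (hy : (Sig (S.scaleChain α k j), y) ∈ (Ce P G).graph) :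
    y + F (S.chain k j) = 0 := by
  suffices key : ∀ j, j < S.n k → (Sig (S.scaleChain α k j)).2 ∈ kerPow G.G₁ (S.freq k) (j + 1) ∧
      ∀ y, (Sig (S.scaleChain α k j), y) ∈ (Ce P G).graph → y + F (S.chain k j) = 0 from
    (key j hj).2 y hy
  clear hy hj y j
  -- Here `p` is the controller component of the predecessor, so that the start of the chain (`p =
  -- 0`) and the induction step are treated alike.
  have step : ∀ j < S.n k, ∀ p, p = (if j = 0 then 0 else (Sig (S.scaleChain α k (j - 1))).2) →
      p ∈ kerPow G.G₁ (S.freq k) j → p ∈ ran (shift G.G₁ (S.freq k)) →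
      (Sig (S.scaleChain α k j)).2 ∈ kerPow G.G₁ (S.freq k) (j + 1) ∧
      ∀ y, (Sig (S.scaleChain α k j), y) ∈ (Ce P G).graph → y + F (S.chain k j) = 0 := by
    intro j hj p hp hker hran
    obtain ⟨a, ha, heq⟩ := hSig.exists_chain k hj
    obtain ⟨c, w, hc, hw, haw⟩ := exists_of_mem_Ae_graph ha
    have h1 := congrArg Prod.snd heq
    have h2 : (if j = 0 then (0 : X × Z) else Sig (S.scaleChain α k (j - 1))).2 = p := by
      rw [hp]
      split_ifs <;> rfl
    have h3 : (Be G E F (S.chain k j)).2 = G.G₂ (F (S.chain k j)) := rfl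
    rw [Prod.snd_add, Prod.snd_add, Prod.smul_snd, h2, haw, h3, add_assoc, ← map_add] at h1
    have h4 : G.G₂ (c + F (S.chain k j)) =
        (S.freq k • (Sig (S.scaleChain α k j)).2 - w) + p := by
      rw [sub_add_eq_add_sub, h1, add_sub_cancel_left]
    have h5 : G.G₂ (c + F (S.chain k j)) ∈
        ran (shift G.G₁ (S.freq k)) ⊓ LinearMap.range G.G₂.toLinearMap := by
      refine ⟨?_, ⟨_, rfl⟩⟩
      rw [h4]
      exact Submodule.add_mem _ (mem_ran_shift.2 ⟨_, _, hw, rfl⟩) hran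
    rw [hG.disjoint, Submodule.mem_bot] at h5
    have h6 : c + F (S.chain k j) = 0 := by
      have : c + F (S.chain k j) ∈ LinearMap.ker G.G₂.toLinearMap := h5
      rwa [hG.injective, Submodule.mem_bot] at this
    refine ⟨⟨-p, mem_shift_graph.2 ?_, neg_mem_kerPow hker⟩, fun y hy => ?_⟩
    · rw [h5] at h4
      have h7 : S.freq k • (Sig (S.scaleChain α k j)).2 - -p = w := by
        rw [sub_neg_eq_add, ← sub_eq_zero, h4]
        abel
      rwa [h7]
    · rwa [LinearPMap.mem_graph_snd_inj _ hy hc rfl]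
  intro j
  induction j with
  | zero => exact fun hj => step 0 hj 0 rfl rfl (Submodule.zero_mem _)
  | succ j ih =>
    intro hj
    have h1 := (ih (by omega)).1
    -- The predecessor lies in the kernel of the power `j + 1`, and `j + 1 < n k` gives `j + 1 ≤ n k
    -- - 1`, the exponent of the chain condition.
    exact step (j + 1) hj _ (by simp) h1 (hG.chains k (kerPow_mono (by omega) h1))

variable [CompleteSpace Z] [CompleteSpace W]

/-- The flow preserves `W_(α+1)`, so the steady-state output cancels `F T_S(t) v₀` at all times.
What remains is `C_e T_e(t)(x₀ - Σ v₀)`, bounded by `T_e(t)` applied to `x₀ - Σ v₀` and to `d = A_e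
(x₀ - Σ v₀)`, both of which tend to zero. -/
theorem GConditions.errorDecays (hα : 0 ≤ α) (hG : GConditions S G)
    (hP : InPertClass S α G P E F) : ErrorDecays S α P G E F := by
  obtain ⟨T, hT, hstab⟩ := hP.stable
  obtain ⟨Sig, hb, he⟩ := hP.sylvester
  have hSig : IsSylvesterSolution S α (Ae P G) (Be G E F) Sig := ⟨hb, he⟩
  obtain ⟨hdom, a, b, hab⟩ := hP.relBounded
  obtain ⟨N, hN⟩ := S.n_bdd
  refine ⟨T, hT, fun x₀ hx₀ v₀ hv₀ => ?_⟩
  have hv₀α : v₀ ∈ S.scale α := (S.scale_mono (by linarith) hv₀).1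
  obtain ⟨d, hd⟩ := LinearPMap.mem_domain_iff.1
    ((Ae P G).domain.sub_mem hx₀ (hSig.mem_domain (v := ⟨v₀, hv₀α⟩) hv₀))
  have hex : ∀ t, ∃ y, 0 ≤ t → (T t (x₀ - Sig ⟨v₀, hv₀α⟩), y) ∈ (Ce P G).graph := by
    intro t
    by_cases ht : 0 ≤ t
    · obtain ⟨y, hy⟩ := LinearPMap.mem_domain_iff.1
        (hdom (LinearPMap.mem_domain_of_mem_graph (hT.graph_apply hd ht)))
      exact ⟨y, fun _ => hy⟩
    · exact ⟨0, fun h => absurd h ht⟩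
  choose e he' using hex
  refine ⟨e, fun t ht => ?_, ?_⟩
  · have hflow := (S.flow_mem_scale hN t hv₀).1
    obtain ⟨y, hy⟩ := LinearPMap.mem_domain_iff.1
      (hdom (hSig.mem_domain (v := S.flowScale α t ⟨v₀, hv₀α⟩) hflow))
    have h1 : y + F (S.flow t v₀) = 0 := hSig.output_eq_zero hα hP.relBounded
      (hG.output_chain_eq_zero hSig) (v := S.flowScale α t ⟨v₀, hv₀α⟩) hflow hy
    refine ⟨e t + y, ?_, by rw [add_assoc, h1, add_zero]⟩
    have h2 := hSig.mildState_eq hα hT ⟨v₀, hv₀α⟩ ht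
    have h3 := mildState_add T (x₀ - Sig ⟨v₀, hv₀α⟩) (Sig ⟨v₀, hv₀α⟩)
      (fun s => Be G E F (S.flow s v₀)) t
    rw [sub_add_cancel] at h3
    rw [h3, h2]
    exact (Ce P G).graph.add_mem (he' t ht) hy
  · have h1 := ((hstab (x₀ - Sig ⟨v₀, hv₀α⟩)).norm.const_mul a).add ((hstab d).norm.const_mul b)
    rw [norm_zero, mul_zero, mul_zero, add_zero] at h1
    refine squeeze_zero_norm' ?_ h1
    filter_upwards [eventually_ge_atTop 0] with t ht
    exact hab _ _ _ (hT.graph_apply hd ht) (he' t ht)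

/-- Robustness with respect to perturbations of `E` and `F` forces the right-hand sides of all
chains of `G₁` with values in the range of `G₂` to vanish. -/
theorem SolvesRORP.chain_eq_zero (hα : 0 ≤ α) (hfreq : ∀ k, S.freq k ∈ rho P.A)
    (hCe : RelBounded (Ae P G) (Ce P G)) (hR : SolvesRORP S α P G E F) (k : ι) {z w : ℕ → Z}
    {y : ℕ → Y} (hzw : ∀ j, (z j, w j) ∈ G.G₁.graph)
    (hy : ∀ j < S.n k, S.freq k • z j - w j + (if j = 0 then 0 else z (j - 1)) = G.G₂ (y j))
    {j : ℕ} (hj : j < S.n k) : y j = 0 := by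
  choose x x' c hc ha using fun j => exists_mem_Ae_graph (P := P) (hzw j)
  -- `E'` and `F'` are whatever the Sylvester equation demands of the operator that sends the `k`-th
  -- chain to `(x_j, z_j)` and the other chains to `0`. Taking `F' φ_k^j = y_j - c_j` turns `G₂ c_j
  -- + G₂ F' φ_k^j` into the prescribed `G₂ y_j`.
  set E' : W →L[ℂ] X :=
    S.chainMap k fun j => S.freq k • x j + (if j = 0 then 0 else x (j - 1)) - x' j with hE'
  set F' : W →L[ℂ] Y := S.chainMap k fun j => y j - c j with hF'
  set σ : ℕ → X × Z := fun j => (x j, z j) with hσ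
  set Sig : S.scale α →ₗ[ℂ] X × Z :=
    (S.chainMap k σ).toLinearMap.comp (S.scale α).subtype with hSigdef
  have hSigv : ∀ v, Sig v = S.chainMap k σ v := fun _ => rfl
  have hSig : IsSylvesterSolution S α (Ae P G) (Be G E' F') Sig := by
    refine ⟨⟨‖S.chainMap k σ‖, fun v => ((S.chainMap k σ).le_opNorm _).trans
      (mul_le_mul_of_nonneg_left (S.norm_le_scaleNorm hα v.2) (norm_nonneg _))⟩, fun v hv => ?_⟩
    obtain ⟨Sv, hSv, hop⟩ := S.exists_mem_op_graph hα hv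
    refine ⟨⟨Sv, hSv⟩, ∑ l : Fin (S.n k), S.coeff k l v • (x' l, w l + G.G₂ (c l)), hop, ?_, ?_⟩
    · have h1 := (Ae P G).graph.sum_mem (t := Finset.univ) fun (l : Fin (S.n k)) _ =>
        (Ae P G).graph.smul_mem (S.coeff k l v) (ha l)
      convert h1 using 1
      rw [hSigv, S.chainMap_apply]
      exact Prod.ext (by rw [Prod.fst_sum]; rfl) (by rw [Prod.snd_sum]; rfl)
    · have h1 : Be G E' F' v = ∑ l : Fin (S.n k), S.coeff k l v •
          ((S.freq k • x l + (if (l : ℕ) = 0 then 0 else x (l - 1)) - x' l,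
            G.G₂ (y l - c l)) : X × Z) := by
        have h2 : Be G E' F' v = (E' v, G.G₂ (F' v)) := rfl
        rw [h2, hE', hF', S.chainMap_apply, S.chainMap_apply, map_sum]
        refine Prod.ext ?_ ?_
        · simp [Prod.fst_sum]
        · simp [Prod.snd_sum]
      rw [hSigv, ← S.chainMap_proj, S.proj_of_mem_op_graph hop, S.chainMap_block, h1,
        ← Finset.sum_add_distrib]
      refine Finset.sum_congr rfl fun l _ => ?_
      rw [← smul_add]
      congr 1
      have h3 := hy l l.2
      refine Prod.ext ?_ ?_
      · simp only [hσ, Prod.fst_add, Prod.smul_fst]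
        split_ifs <;> simp
      · simp only [hσ, Prod.snd_add, Prod.smul_snd, map_sub, ← h3]
        split_ifs <;> simp <;> abel
  -- The plant is unchanged, so only solvability of the Sylvester equation had to be checked. The
  -- output on the chain is `c_j + (y_j - c_j) = y_j`.
  obtain ⟨T, hT, hdecay⟩ := hR.robust P E' F' ⟨hfreq, hR.stable, hCe, Sig, hSig.bound, hSig.eq⟩
  have hcj : (Sig (S.scaleChain α k j), c j) ∈ (Ce P G).graph := by
    have h1 : Sig (S.scaleChain α k j) = σ j := S.chainMap_chain k σ hj
    rw [h1]
    exact hc j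
  have h2 := hSig.output_chain_eq_zero hT hCe.1 hdecay k j hj (c j) hcj
  rw [hF', S.chainMap_chain k _ hj] at h2
  simpa using h2

theorem SolvesRORP.gConditions [Nonempty ι] (hα : 0 ≤ α) (hfreq : ∀ k, S.freq k ∈ rho P.A)
    (hCe : RelBounded (Ae P G) (Ce P G))
    (hZ : ∀ k, ran (shift G.G₁ (S.freq k)) ⊔ LinearMap.range G.G₂.toLinearMap = ⊤)
    (hR : SolvesRORP S α P G E F) : GConditions S G := by
  -- a chain of kernel elements of length `n_k - 1`, prolonged by one element of `Dom(G₁)`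
  have key : ∀ k, ∀ p ∈ kerPow G.G₁ (S.freq k) (S.n k - 1), ∀ z w y, (z, w) ∈ G.G₁.graph →
      S.freq k • z - w + p = G.G₂ y → y = 0 := by
    intro k p hp z w y hzw hy
    have hn := S.n_pos k
    obtain ⟨z', w', h1, h2, h3⟩ := exists_chain_of_mem_kerPow hp
    have := hR.chain_eq_zero hα hfreq hCe k (z := Function.update z' (S.n k - 1) z)
      (w := Function.update w' (S.n k - 1) w) (y := Function.update 0 (S.n k - 1) y)
      (fun j => ?_) (fun j hj => ?_) (j := S.n k - 1) (by omega)
    · simpa using this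
    · rcases eq_or_ne j (S.n k - 1) with rfl | hj
      · simpa using hzw
      · simpa [hj] using h1 j
    · have h6 : (if j = 0 then 0 else Function.update z' (S.n k - 1) z (j - 1)) =
          if j = 0 then 0 else z' (j - 1) := by
        split_ifs with h0
        · rfl
        · rw [Function.update_of_ne (by omega)]
      rw [h6]
      rcases eq_or_ne j (S.n k - 1) with rfl | hjm
      · rw [h3]
        simpa using hy
      · simpa [hjm] using h2 j (by omega)
  refine ⟨fun k => ?_, ?_, fun k p hp => ?_⟩
  · rw [Submodule.eq_bot_iff]
    rintro _ ⟨h1, ⟨y, rfl⟩⟩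
    obtain ⟨z, w, hzw, h2⟩ := mem_ran_shift.1 h1
    rw [key k 0 (zero_mem_kerPow _) z w y hzw (by rw [add_zero]; exact h2), map_zero]
  · rw [Submodule.eq_bot_iff]
    intro y hy
    -- Any frequency serves here, with the zero chain; this is where non-emptiness of the index set
    -- enters.
    refine key (Classical.arbitrary ι) 0 (zero_mem_kerPow _) 0 0 y G.G₁.graph.zero_mem ?_
    have hy : G.G₂ y = 0 := hy
    simp [hy]
  · have h1 : p ∈ ran (shift G.G₁ (S.freq k)) ⊔ LinearMap.range G.G₂.toLinearMap := by
      rw [hZ]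
      trivial
    obtain ⟨q, hq, _, ⟨y, rfl⟩, rfl⟩ := Submodule.mem_sup.1 h1
    obtain ⟨z, w, hzw, rfl⟩ := mem_ran_shift.1 hq
    -- Prolonging the chain that ends in `p = (i ω_k - G₁) z + G₂ y` by `-z` leaves the right-hand
    -- side `G₂ y`. Hence `y = 0` and `p` lies in the range.
    have hy : y = 0 := key k _ hp (-z) (-w) y (G.G₁.graph.neg_mem hzw) (by
      rw [smul_neg]
      change _ + (_ + G.G₂ y) = _
      abel)
    rw [hy, map_zero, add_zero]
    exact hq

end Regulation

end RobustReg

end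

/-- In the sufficiency direction the nominal system itself belongs to the perturbation class, so one
decay statement covers both regulation and robustness. -/
theorem mainTheorem2 {ι X U Y Z W : Type*} [Countable ι] [Nonempty ι]
    [NormedAddCommGroup X] [NormedSpace ℂ X] [CompleteSpace X]
    [NormedAddCommGroup U] [NormedSpace ℂ U] [CompleteSpace U]
    [NormedAddCommGroup Y] [NormedSpace ℂ Y] [CompleteSpace Y]
    [NormedAddCommGroup Z] [NormedSpace ℂ Z] [CompleteSpace Z]
    [NormedAddCommGroup W] [InnerProductSpace ℂ W] [CompleteSpace W]
    (S : RobustReg.Exosystem ι W) (α : ℝ) (hα : 0 ≤ α)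
    (P : RobustReg.Plant X U Y) (E : W →L[ℂ] X) (F : W →L[ℂ] Y)
    (G : RobustReg.Controller Y Z U)
    (hfreq : ∀ k, S.freq k ∈ RobustReg.rho P.A)
    (hstable : RobustReg.StablyGenerates P G)
    (hCe : RobustReg.RelBounded (RobustReg.Ae P G) (RobustReg.Ce P G))
    (hZ : ∀ k, RobustReg.ran (RobustReg.shift G.G₁ (S.freq k)) ⊔
      LinearMap.range G.G₂.toLinearMap = ⊤)
    (hSyl : RobustReg.SylvesterSolvable S α P G E F) :
    RobustReg.SolvesRORP S α P G E F ↔ RobustReg.GConditions S G :=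
  ⟨fun hR => hR.gConditions hα hfreq hCe hZ, fun hG =>
    ⟨hstable, hG.errorDecays hα ⟨hfreq, hstable, hCe, hSyl⟩,
      fun _ _ _ hP => hG.errorDecays hα hP⟩⟩
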